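/- Let $\{d(n)\}_{n\in\mathbb Z}$ and $\{z(n)\}_{n\in\mathbb Z}$ be complex second-order cyclostationary processes of period $P\ge 1$ (i.e. $\mathbb E|d(n)|^2<\infty$ and $r_d(n,m)=\mathbb E[d(n+m)d^*(n)]$ is $P$-periodic in $n$; same for $z$), mutually uncorrelated ($\mathbb E[d(n)z^*(n')]=0$ for all $n,n'$), one of which is white with positive power, and let $x(n)=d(n)+z(n)$. Assume that the cyclic spectra exist as integrable densities: for $(a,b)\in\{(d,d),(x,x),(d,x)\}$ and $k\in\mathbb Z$, $S_{AB}^{(k/P)}\in L^1[0,1)$ satisfies $\frac1P\sum_{n=0}^{P-1}\mathbb E[a(n+m)b^*(n)]e^{-i2\pi kn/P}=\int_0^1S_{AB}^{(k/P)}(f)e^{i2\pi fm}\,df$ for all $m\in\mathbb Z$. For $\sigma\in[0,1/P)$ and $0\le r,c<P$ put $[\mathbf S_{AB}(\sigma)]_{r,c}=S_{AB}^{((r-c)/P)}(\sigma+r/P)$, $\mathbf S_D=\mathbf S_{DD}$, $\mathbf S_X=\mathbf S_{XX}$. Write $x(n)=\sum_{q=0}^{P-1}\int_0^{1/P}e^{i2\pi(\sigma+q/P)n}\,d\nu_x^{(q)}(\sigma)$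 for the spectral representation of $x$, where $\mathbb E[d\nu_x^{(r)}(\sigma)\,d\nu_x^{(c)*}(\sigma')]=[\mathbf S_X(\sigma)]_{r,c}\,\delta(\sigma-\sigma')\,d\sigma\,d\sigma'$. The asymptotic error power of an estimate $\hat d$ is $\mathrm{MSE}_{\mathrm{nc}}=\lim_{N\to\infty}\frac{1}{N-1}\sum_{n=-N/2}^{N/2-1}\mathbb E|d(n)-\hat d(n)|^2$ ($N$ even). A FRESH filter, with responses $W_q(f)$, $0\le q<P$, produces $d\nu_{\hat d}^{(p)}(\sigma)=\sum_{q}W_q^*(\sigma+p/P)\,d\nu_x^{(p+q\bmod P)}(\sigma)$. The cyclic Wiener filter (CWF) is the FRESH filter of least $\mathrm{MSE}_{\mathrm{nc}}$. Let $\mathbf B(\sigma)=[\mathbf b^{(0)}(\sigma),\dots,\mathbf b^{(P-1)}(\sigma)]$ be any unitary matrix, measurable in $\sigma$, whose columns are, for almost every $\sigma$, eigenvectors of $\mathbf S_X(\sigma)$ (a KL basis of $x$). Let $\phi^{(p)}(n,\sigma)=\sum_qb^{(p)}(q,\sigma)e^{i2\pi(\sigma+q/P)n}$, and let $d\xi_x^{(p)}$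 be the orthogonal increments, of density the eigenvalue of $\mathbf b^{(p)}(\sigma)$, with $x(n)=\sum_p\int_0^{1/P}\phi^{(p)}(n,\sigma)\,d\xi_x^{(p)}(\sigma)$. A scalar filter in the KL domain produces $d\xi_{\hat d}^{(p)}(\sigma)=\mathcal W_p^*(\sigma)\,d\xi_x^{(p)}(\sigma)$; the KL Wiener filter is the scalar filter of least $\mathrm{MSE}_{\mathrm{nc}}$. Put $\mathcal S_D^{(p)},\mathcal S_X^{(p)},\mathcal S_{DX}^{(p)}=[\mathbf B^H\mathbf S_{\bullet}\mathbf B]_{p,p}$ with $\bullet=D,X,DX$. Then, up to null sets of $\sigma$: 1. the CWF exists, is unique, and is given by $W_q(\sigma+p/P)=[\mathbf S_X^{-1}(\sigma)\mathbf S_{DX}^H(\sigma)]_{p+q\bmod P,\,p}$; at every $n$ its output has mean square error no larger than that of any finite linear combination of the $x(m)$, $m\in\mathbb Z$; 2. $\mathbf B$ is also an eigenbasis of $\mathbf S_D$; the KL Wiener filter exists, is unique, and is the scalar Wiener filter applied pointwise, $\mathcal W_p=\mathcal S_{DX}^{(p)*}/\mathcal S_X^{(p)}$; 3. the CWF and the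 KL Wiener filter are equivalent: they have the same output process $\{\hat d(n)\}$ (almost surely for each $n$), hence the same least error power $\mathrm{MMSE}_{\mathrm{nc}}$; 4. with $|\gamma_p|^2=|\mathcal S_{DX}^{(p)}|^2/(\mathcal S_X^{(p)}\mathcal S_D^{(p)})$ (and $0$ where $\mathcal S_D^{(p)}=0$) and $\mathbf C_{DX}=\mathbf S_D^{-1/2}\mathbf S_{DX}\mathbf S_X^{-1/2}$ (with the pseudo-inverse of $\mathbf S_D$ where it is singular), and all the integrands being integrable, $$\mathrm{MMSE}_{\mathrm{nc}}=\sum_{p=0}^{P-1}\int_0^{1/P}\mathcal S_D^{(p)}(\sigma)\bigl(1-|\gamma_p(\sigma)|^2\bigr)\,d\sigma=\int_0^{1/P}\operatorname{tr}\bigl[\mathbf S_D(\sigma)\bigl(\mathbf I-\mathbf C_{DX}(\sigma)\mathbf C_{DX}^H(\sigma)\bigr)\bigr]\,d\sigma;$$ 5. if $z$ is white with power $P_z>0$, then $\mathrm{MMSE}_{\mathrm{nc}}=P_z\int_0^{1/P}\operatorname{tr}\bigl[\mathbf S_D(\sigma)\bigl(\mathbf S_D(\sigma)+P_z\mathbf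 I\bigr)^{-1}\bigr]\,d\sigma$. -/

import Mathlib

open MeasureTheory Filter Topology
open scoped Matrix ComplexConjugate

noncomputable section

/-- The exponential `exp(2 π i t)`. -/
def cexp2pi (t : ℝ) : ℂ := Complex.exp (2 * Real.pi * Complex.I * (t : ℂ))

/-- Lebesgue measure on the spectral sub-band `[0, 1/P)`. -/
def band (P : ℕ) : Measure ℝ := volume.restrict (Set.Ico (0 : ℝ) (1 / (P : ℝ)))

section Processes

variable {Ω : Type*} [MeasurableSpace Ω]

/-- Correlation function `r_{xy}(n, m) = E[x(n+m) y(n)^*]` with time `n` and lag `m`. -/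
def corr (μ : Measure Ω) (x y : ℤ → Ω → ℂ) (n m : ℤ) : ℂ :=
  ∫ ω, x (n + m) ω * conj (y n ω) ∂μ

/-- A second-order process whose autocorrelation is `P`-periodic in time. -/
def IsCyclostationary (μ : Measure Ω) (P : ℕ) (x : ℤ → Ω → ℂ) : Prop :=
  (∀ n, MemLp (x n) 2 μ) ∧
    ∀ n m l : ℤ, corr μ x x (n + l * (P : ℤ)) m = corr μ x x n m

/-- A second-order white process of power `p`. -/
def IsWhite (μ : Measure Ω) (p : ℝ) (x : ℤ → Ω → ℂ) : Prop :=
  (∀ n, MemLp (x n) 2 μ) ∧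
    ∀ n m : ℤ, corr μ x x n m = if m = 0 then (p : ℂ) else 0

/-- `S k` is the cyclic (cross-)spectrum at the cycle frequency `k / P`: the spectral density
whose Fourier coefficients are the cyclic correlations
`(1/P) ∑_{n < P} r(n, m) exp(-2 π i k n / P)`. It is unique up to null sets, and is given by
`S k f = (1/P) ∑_{n < P} ∑_m r(n, m) exp(-2 π i (k n / P + f m))` whenever the series over `m`
converges absolutely. -/
def IsCyclicSpectrum (P : ℕ) (r : ℤ → ℤ → ℂ) (S : ℤ → ℝ → ℂ) : Prop :=
  (∀ k, IntegrableOn (S k) (Set.Ico (0 : ℝ) 1)) ∧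
    ∀ k m : ℤ,
      (1 / (P : ℂ)) * ∑ n ∈ Finset.range P, r (n : ℤ) m * cexp2pi (-((k : ℝ) * (n : ℝ) / (P : ℝ)))
        = ∫ f in Set.Ico (0 : ℝ) 1, S k f * cexp2pi (f * (m : ℝ))

/-- The cyclic PSD matrix, `[S(σ)]_{r,c} = S^{((r-c)/P)}(σ + r/P)`. -/
def cycMat (P : ℕ) (S : ℤ → ℝ → ℂ) (σ : ℝ) : Matrix (Fin P) (Fin P) ℂ :=
  Matrix.of fun r c => S ((r.val : ℤ) - (c.val : ℤ)) (σ + (r.val : ℝ) / (P : ℝ))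

/-- Let the process `x` have a spectral representation
`x(n) = ∫ ∑_q e(n,σ)_q dζ^{(q)}(σ)` over `[0, 1/P)`, with
`E[dζ^{(r)}(σ) dζ^{(c)}(σ')^*] = K(σ)_{r,c} δ(σ-σ') dσ dσ'`.
This says `Y = ∫ ∑_q h(σ)_q dζ^{(q)}(σ)`. As usual, the integral is the isometric extension of
`∑_n c_n e(n,·) ↦ ∑_n c_n x(n)`: finite combinations of the `e(n,·)` tend to `h` in the
`L²` seminorm `∫ ∑_{r,c} h_r K_{r,c} h_c^* dσ`, and those of the `x(n)` tend to `Y` in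
mean square. -/
def HasSpectralIntegral (μ : Measure Ω) (P : ℕ) (x : ℤ → Ω → ℂ)
    (e : ℤ → ℝ → Fin P → ℂ) (K : ℝ → Matrix (Fin P) (Fin P) ℂ)
    (h : ℝ → Fin P → ℂ) (Y : Ω → ℂ) : Prop :=
  AEStronglyMeasurable h (band P) ∧ MemLp Y 2 μ ∧
    ∃ c : ℕ → (ℤ →₀ ℂ),
      Tendsto (fun k => ∫⁻ σ, ENNReal.ofReal
          ((h σ - (c k).sum fun n a => a • e n σ) ⬝ᵥ
            (K σ *ᵥ star (h σ - (c k).sum fun n a => a • e n σ))).re ∂(band P))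
        atTop (𝓝 0) ∧
      Tendsto (fun k => eLpNorm (Y - (c k).sum fun n a => a • x n) 2 μ) atTop (𝓝 0)

/-- The Fourier basis split into `P` sub-bands: `exp(2 π i (σ + q/P) n)`. -/
def clBasis (P : ℕ) (n : ℤ) (σ : ℝ) (q : Fin P) : ℂ :=
  cexp2pi ((σ + (q.val : ℝ) / (P : ℝ)) * (n : ℝ))

/-- `Y = ∫ ∑_q h_q(σ) dν_x^{(q)}(σ)` in the Cramér–Loève domain, where
`x(n) = ∑_q ∫ exp(2 π i (σ + q/P) n) dν_x^{(q)}(σ)` and `SX` is the cyclic PSD matrix of `x`. -/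
def HasCLIntegral (μ : Measure Ω) (P : ℕ) (x : ℤ → Ω → ℂ)
    (SX : ℝ → Matrix (Fin P) (Fin P) ℂ) (h : ℝ → Fin P → ℂ) (Y : Ω → ℂ) : Prop :=
  HasSpectralIntegral μ P x (clBasis P) SX h Y

/-- The columns `b^{(p)}(σ)` of `B σ` are an orthonormal eigenbasis of the cyclic PSD matrix
`M σ`, depending measurably on `σ`. -/
def IsKLBasis (P : ℕ) (M B : ℝ → Matrix (Fin P) (Fin P) ℂ) : Prop :=
  (∀ i j, AEMeasurable (fun σ => B σ i j) (band P)) ∧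
    ∀ᵐ σ ∂(band P), B σ ∈ Matrix.unitaryGroup (Fin P) ℂ ∧
      ∃ ev : Fin P → ℝ, ∀ p, M σ *ᵥ (B σ)ᵀ p = (ev p : ℂ) • (B σ)ᵀ p

/-- The diagonal entry `b^{(p)}(σ)^H M(σ) b^{(p)}(σ)`. If `M` is a cyclic PSD matrix and `B` an
eigenbasis of it, this is the eigenvalue of `b^{(p)}(σ)`, that is, the KL spectrum; for a
cross-spectral matrix it is the KL cross-spectrum. -/
def klSpec (P : ℕ) (M B : ℝ → Matrix (Fin P) (Fin P) ℂ) (p : Fin P) (σ : ℝ) : ℂ :=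
  ((B σ)ᴴ * M σ * B σ) p p

/-- KL eigenfunctions `φ^{(p)}(n,σ) = ∑_q b^{(p)}(q,σ) exp(2 π i (σ + q/P) n)`. -/
def klBasis (P : ℕ) (B : ℝ → Matrix (Fin P) (Fin P) ℂ) (n : ℤ) (σ : ℝ) (p : Fin P) : ℂ :=
  ∑ q, B σ q p * clBasis P n σ q

/-- `Y = ∫ ∑_p h_p(σ) dξ_x^{(p)}(σ)` in the Karhunen–Loève domain, where
`x(n) = ∑_p ∫ φ^{(p)}(n,σ) dξ_x^{(p)}(σ)` and the increments `dξ_x^{(p)}` are orthogonal with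
densities the KL spectrum of `x`. -/
def HasKLIntegral (μ : Measure Ω) (P : ℕ) (x : ℤ → Ω → ℂ)
    (SX B : ℝ → Matrix (Fin P) (Fin P) ℂ) (h : ℝ → Fin P → ℂ) (Y : Ω → ℂ) : Prop :=
  HasSpectralIntegral μ P x (klBasis P B)
    (fun σ => Matrix.diagonal fun p => klSpec P SX B p σ) h Y

/-- `dhat` is the output, for input `x`, of the FRESH filter with branch responses `W_q(f)`:
`dν_dhat^{(p)}(σ) = ∑_q W_q(σ + p/P)^* dν_x^{(p+q mod P)}(σ)`, collected here by `j = p + q`. -/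
def IsFreshOutput (μ : Measure Ω) (P : ℕ) [NeZero P] (x : ℤ → Ω → ℂ)
    (SX : ℝ → Matrix (Fin P) (Fin P) ℂ) (W : Fin P → ℝ → ℂ) (dhat : ℤ → Ω → ℂ) : Prop :=
  ∀ n, HasCLIntegral μ P x SX
    (fun σ j => ∑ p : Fin P, clBasis P n σ p * conj (W (j - p) (σ + (p.val : ℝ) / (P : ℝ))))
    (dhat n)

/-- `dhat` is the output, for input `x`, of the scalar filter `W_p(σ)` in the KL domain:
`dξ_dhat^{(p)}(σ) = W_p(σ)^* dξ_x^{(p)}(σ)`. -/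
def IsKLOutput (μ : Measure Ω) (P : ℕ) (x : ℤ → Ω → ℂ)
    (SX B : ℝ → Matrix (Fin P) (Fin P) ℂ) (W : Fin P → ℝ → ℂ) (dhat : ℤ → Ω → ℂ) : Prop :=
  ∀ n, HasKLIntegral μ P x SX B (fun σ p => klBasis P B n σ p * conj (W p σ)) (dhat n)

/-- Average error power over `N₁ ≤ n ≤ N₂`. -/
def mse (μ : Measure Ω) (d dhat : ℤ → Ω → ℂ) (N₁ N₂ : ℤ) : ℝ :=
  1 / ((N₂ : ℝ) - (N₁ : ℝ)) * ∑ n ∈ Finset.Icc N₁ N₂, ∫ ω, ‖d n ω - dhat n ω‖ ^ 2 ∂μ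

/-- `L` is the asymptotic average error power, the limit of `mse (-N/2) (N/2 - 1)` over even
`N = 2 K`. -/
def HasMSE (μ : Measure Ω) (d dhat : ℤ → Ω → ℂ) (L : ℝ) : Prop :=
  Tendsto (fun K : ℕ => mse μ d dhat (-(K : ℤ)) ((K : ℤ) - 1)) atTop (𝓝 L)

/-- Error powers achieved by FRESH filters. -/
def freshMSEs (μ : Measure Ω) (P : ℕ) [NeZero P] (d x : ℤ → Ω → ℂ)
    (SX : ℝ → Matrix (Fin P) (Fin P) ℂ) : Set ℝ :=
  {L | ∃ W dhat, IsFreshOutput μ P x SX W dhat ∧ HasMSE μ d dhat L}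

/-- Error powers achieved by scalar filters in the KL domain. -/
def klMSEs (μ : Measure Ω) (P : ℕ) (d x : ℤ → Ω → ℂ)
    (SX B : ℝ → Matrix (Fin P) (Fin P) ℂ) : Set ℝ :=
  {L | ∃ W dhat, IsKLOutput μ P x SX B W dhat ∧ HasMSE μ d dhat L}

/-- The cyclic Wiener filter: a FRESH filter of least error power. -/
def IsCyclicWiener (μ : Measure Ω) (P : ℕ) [NeZero P] (d x : ℤ → Ω → ℂ)
    (SX : ℝ → Matrix (Fin P) (Fin P) ℂ) (W : Fin P → ℝ → ℂ) : Prop :=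
  ∃ dhat L, IsFreshOutput μ P x SX W dhat ∧ HasMSE μ d dhat L ∧
    IsLeast (freshMSEs μ P d x SX) L

/-- The KL Wiener filter: a scalar filter in the KL domain of least error power. -/
def IsKLWiener (μ : Measure Ω) (P : ℕ) (d x : ℤ → Ω → ℂ)
    (SX B : ℝ → Matrix (Fin P) (Fin P) ℂ) (W : Fin P → ℝ → ℂ) : Prop :=
  ∃ dhat L, IsKLOutput μ P x SX B W dhat ∧ HasMSE μ d dhat L ∧
    IsLeast (klMSEs μ P d x SX B) L

end Processes

/-- Squared spectral coherence `|γ_p|² = |S_DX^{(p)}|² / (S_X^{(p)} S_D^{(p)})` in the KL domain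
(zero where the denominator vanishes). -/
def klCohSq (P : ℕ) (SD SX SDX B : ℝ → Matrix (Fin P) (Fin P) ℂ) (p : Fin P) (σ : ℝ) : ℝ :=
  ‖klSpec P SDX B p σ‖ ^ 2 / ((klSpec P SX B p σ).re * (klSpec P SD B p σ).re)

/-- `A^{-1/2}` for a positive semidefinite matrix (of the pseudo-inverse, if `A` is singular). -/
def invSqrt {P : ℕ} (A : Matrix (Fin P) (Fin P) ℂ) : Matrix (Fin P) (Fin P) ℂ :=
  cfc (fun t : ℝ => (Real.sqrt t)⁻¹) A

/-- Coherence matrix `C_DX = S_D^{-1/2} S_DX S_X^{-1/2}`. -/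
def cohMat {P : ℕ} (SD SDX SX : Matrix (Fin P) (Fin P) ℂ) : Matrix (Fin P) (Fin P) ℂ :=
  invSqrt SD * SDX * invSqrt SX

end

/-! A spectral integral with respect to the representation of `x` is the isometric image of its
kernel in `L²(S_X)`, and the exponentials span a dense subspace there. Hence estimating `d(n)`
from `x` is projecting onto this space, and the projection is multiplication by `S_D S_X⁻¹`, since
`S_DX = S_D`: signal and noise are uncorrelated. A periodically varying filter exceeds the power
of the projection error by the average of `‖(M - S_D S_X⁻¹) e_n‖²` over one period, which vanishes
only for the Wiener filter, as the exponentials `e_0, …, e_{P-1}` separate the sub-bands. FRESH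
filters realize every matrix response, whereas scalar filters in the KL domain realize those
diagonal in the eigenbasis of `S_X`. Whiteness of one component makes `S_D` and `S_X` differ by a
scalar, or `S_D` itself scalar, so that `S_D S_X⁻¹` is diagonal in that eigenbasis and both
classes of filters contain the same optimum. -/

noncomputable section

open Finsupp (linearCombination linearCombination_apply)
open scoped ENNReal ComplexOrder

section Exponential

theorem cexp2pi_eq_fourierChar (t : ℝ) : cexp2pi t = Real.fourierChar t := by
  rw [cexp2pi, Real.fourierChar_apply]
  push_cast
  ring_nf

theorem cexp2pi_zero : cexp2pi 0 = 1 := by simp [cexp2pi]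

theorem cexp2pi_add (s t : ℝ) : cexp2pi (s + t) = cexp2pi s * cexp2pi t := by
  simp only [cexp2pi_eq_fourierChar, AddChar.map_add_eq_mul, Circle.coe_mul]

theorem conj_cexp2pi (t : ℝ) : conj (cexp2pi t) = cexp2pi (-t) := by
  simp only [cexp2pi_eq_fourierChar, AddChar.map_neg_eq_inv, Circle.coe_inv_eq_conj]

theorem norm_cexp2pi (t : ℝ) : ‖cexp2pi t‖ = 1 := by
  rw [cexp2pi_eq_fourierChar, Circle.norm_coe]

@[fun_prop]
theorem continuous_cexp2pi : Continuous cexp2pi := by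
  unfold cexp2pi
  fun_prop

theorem cexp2pi_natCast_mul (k : ℕ) (t : ℝ) : cexp2pi (k * t) = cexp2pi t ^ k := by
  simp only [cexp2pi_eq_fourierChar, ← nsmul_eq_mul, AddChar.map_nsmul_eq_pow, Circle.coe_pow]

theorem cexp2pi_eq_one_iff (t : ℝ) : cexp2pi t = 1 ↔ ∃ n : ℤ, t = n := by
  have h2 : (2 * Real.pi * Complex.I : ℂ) ≠ 0 := by simp [Real.pi_ne_zero]
  rw [cexp2pi, Complex.exp_eq_one_iff]
  refine exists_congr fun n => ?_
  rw [mul_comm (n : ℂ), mul_right_inj' h2]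
  norm_cast

theorem cexp2pi_intCast (n : ℤ) : cexp2pi n = 1 := (cexp2pi_eq_one_iff _).2 ⟨n, rfl⟩

theorem cexp2pi_add_intCast (t : ℝ) (n : ℤ) : cexp2pi (t + n) = cexp2pi t := by
  rw [cexp2pi_add, cexp2pi_intCast, mul_one]

theorem fourier_coe_eq_cexp2pi {T : ℝ} (n : ℤ) (t : ℝ) :
    fourier n (t : AddCircle T) = cexp2pi (n * t / T) := by
  rw [fourier_coe_apply, cexp2pi]
  push_cast
  ring_nf

end Exponential

section TrigonometricDensity

variable {p : ℝ≥0∞} [Fact (1 ≤ p)] {T : ℝ} [Fact (0 < T)]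

theorem exists_eLpNorm_sub_fourier_le (ρ : Measure (AddCircle T)) [IsFiniteMeasure ρ]
    (hp : p ≠ ∞) {G : AddCircle T → ℂ} (hG : MemLp G p ρ) {ε : ℝ≥0∞} (hε : ε ≠ 0) :
    ∃ c : ℤ →₀ ℂ, eLpNorm (G - ⇑(linearCombination ℂ (fourier (T := T)) c)) p ρ ≤ ε := by
  have htop := (ContinuousMap.toLp_denseRange (p := p) ℂ ρ ℂ hp).topologicalClosure_map_submodule
    (span_fourier_closure_eq_top (T := T))
  have hmem : hG.toLp G ∈ closure (((Submodule.span ℂ (Set.range (fourier (T := T)))).map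
      (ContinuousMap.toLp p ρ ℂ).toLinearMap : Submodule ℂ (Lp ℂ p ρ)) : Set (Lp ℂ p ρ)) := by
    rw [← Submodule.topologicalClosure_coe]
    exact htop.ge Submodule.mem_top
  obtain ⟨_, ⟨f, hf, rfl⟩, hdist⟩ := EMetric.mem_closure_iff.1 hmem ε (pos_iff_ne_zero.2 hε)
  obtain ⟨c, rfl⟩ := Finsupp.mem_span_range_iff_exists_finsupp.1 hf
  refine ⟨c, (eLpNorm_congr_ae ?_).trans_le ((Lp.edist_def _ _).symm.trans_le hdist.le)⟩
  exact (hG.coeFn_toLp.sub (ContinuousMap.coeFn_toLp ρ _)).symm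

theorem exists_eLpNorm_sub_cexp2pi_le (ρ : Measure ℝ) [IsFiniteMeasure ρ]
    (hρ : ∀ᵐ t ∂ρ, t ∈ Set.Ico 0 T) (hp : p ≠ ∞) {G : ℝ → ℂ} (hG : MemLp G p ρ)
    {ε : ℝ≥0∞} (hε : ε ≠ 0) :
    ∃ c : ℤ →₀ ℂ,
      eLpNorm (G - linearCombination ℂ (fun (n : ℤ) t => cexp2pi (n * t / T)) c) p ρ ≤ ε := by
  let toCircle : ℝ → AddCircle T := (↑)
  let lift : AddCircle T → ℝ := fun s => AddCircle.equivIco T 0 s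
  have htoCircle : Measurable toCircle := AddCircle.measurable_mk'
  have hlift : Measurable lift :=
    measurable_subtype_coe.comp (AddCircle.measurableEquivIco T 0).measurable
  have hinv : lift ∘ toCircle =ᵐ[ρ] id := by
    filter_upwards [hρ] with t ht
    simp only [lift, toCircle, Function.comp_apply, id_eq,
      AddCircle.equivIco_coe_eq (show t ∈ Set.Ico 0 (0 + T) by rwa [zero_add])]
  have hmap : (ρ.map toCircle).map lift = ρ := by
    rw [Measure.map_map hlift htoCircle, Measure.map_congr hinv, Measure.map_id]
  have hG' : MemLp (G ∘ lift) p (ρ.map toCircle) := by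
    rw [← memLp_map_measure_iff (hmap.symm ▸ hG.1) hlift.aemeasurable, hmap]
    exact hG
  obtain ⟨c, hc⟩ := exists_eLpNorm_sub_fourier_le (ρ.map toCircle) hp hG' hε
  refine ⟨c, le_of_eq_of_le ?_ hc⟩
  rw [eLpNorm_map_measure (hG'.1.sub (by fun_prop)) htoCircle.aemeasurable]
  refine eLpNorm_congr_ae ?_
  filter_upwards [hinv] with t ht
  simp only [Function.comp_apply, id_eq] at ht
  simp only [Function.comp_apply, Pi.sub_apply, ht, linearCombination_apply, Finsupp.sum,
    ContinuousMap.coe_sum, ContinuousMap.coe_smul, Finset.sum_apply, Pi.smul_apply, toCircle,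
    fourier_coe_eq_cexp2pi]

end TrigonometricDensity

section FourierUniqueness

theorem integrable_mul_cexp2pi {α : Type*} [MeasurableSpace α] [TopologicalSpace α]
    [OpensMeasurableSpace α] {ν : Measure α} {F : α → ℂ} (hF : Integrable F ν)
    {g : α → ℝ} (hg : Continuous g) : Integrable (fun t => F t * cexp2pi (g t)) ν :=
  hF.mul_bdd (c := 1) (by fun_prop) (Eventually.of_forall fun _ => (norm_cexp2pi _).le)

theorem enorm_integral_mul_le {α : Type*} [MeasurableSpace α] {ν : Measure α} {F G : α → ℂ}
    (hF : AEStronglyMeasurable F ν) (hG : AEStronglyMeasurable G ν) :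
    ‖∫ t, F t * G t ∂ν‖ₑ ≤ eLpNorm G 1 (ν.withDensity fun t => ‖F t‖ₑ) := by
  rw [eLpNorm_one_eq_lintegral_enorm,
    lintegral_withDensity_eq_lintegral_mul₀ hF.enorm hG.enorm]
  simpa only [enorm_mul, Pi.mul_apply] using
    enorm_integral_le_lintegral_enorm (μ := ν) fun t => F t * G t

variable {T : ℝ} {ν : Measure ℝ} {F : ℝ → ℂ}

theorem integral_mul_linearCombination_cexp2pi_eq_zero (hF : Integrable F ν)
    (h0 : ∀ n : ℤ, ∫ t, F t * cexp2pi (n * t / T) ∂ν = 0) (c : ℤ →₀ ℂ) :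
    Integrable
        (fun t => F t * linearCombination ℂ (fun (n : ℤ) t => cexp2pi (n * t / T)) c t) ν ∧
      ∫ t, F t * linearCombination ℂ (fun (n : ℤ) t => cexp2pi (n * t / T)) c t ∂ν = 0 := by
  induction c using Finsupp.induction_linear with
  | zero => simp
  | add c c' hc hc' =>
    simp only [map_add, Pi.add_apply, mul_add]
    exact ⟨hc.1.add hc'.1, by rw [integral_add hc.1 hc'.1, hc.2, hc'.2, add_zero]⟩
  | single n a =>
    simp only [Finsupp.linearCombination_single, Pi.smul_apply, smul_eq_mul, mul_left_comm _ a]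
    exact ⟨(integrable_mul_cexp2pi hF (by fun_prop)).const_mul a,
      by rw [integral_const_mul, h0, mul_zero]⟩

theorem ae_eq_zero_of_integral_mul_cexp2pi_eq_zero [Fact (0 < T)]
    (hν : ∀ᵐ t ∂ν, t ∈ Set.Ico 0 T) (hF : Integrable F ν)
    (h0 : ∀ n : ℤ, ∫ t, F t * cexp2pi (n * t / T) ∂ν = 0) : F =ᵐ[ν] 0 := by
  refine hF.ae_eq_zero_of_forall_setIntegral_eq_zero fun s hs _ => ?_
  let ρ := ν.withDensity fun t => ‖F t‖ₑ
  have : IsFiniteMeasure ρ := isFiniteMeasure_withDensity hF.2.ne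
  have hρ : ρ ≪ ν := withDensity_absolutelyContinuous _ _
  let H : ℝ → ℂ := s.indicator 1
  have hH : StronglyMeasurable H := stronglyMeasurable_one.indicator hs
  have hHbound (t : ℝ) : ‖H t‖ ≤ 1 := by
    simpa using norm_indicator_le_norm_self (s := s) (1 : ℝ → ℂ) t
  have hFH : Integrable (fun t => F t * H t) ν :=
    hF.mul_bdd (c := 1) hH.aestronglyMeasurable (Eventually.of_forall hHbound)
  have hsH : ∫ t in s, F t ∂ν = ∫ t, F t * H t ∂ν := by
    rw [← integral_indicator hs]
    congr with t
    by_cases ht : t ∈ s <;> simp [H, ht]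
  rw [hsH, ← enorm_eq_zero, ← nonpos_iff_eq_zero]
  refine le_of_forall_gt_imp_ge_of_dense fun ε hε => ?_
  obtain ⟨c, hc⟩ := exists_eLpNorm_sub_cexp2pi_le (p := 1) ρ (hρ.ae_le hν) ENNReal.one_ne_top
    (.of_bound hH.aestronglyMeasurable 1 (Eventually.of_forall hHbound)) hε.ne'
  set g := linearCombination ℂ (fun (n : ℤ) t => cexp2pi (n * t / T)) c with hg
  have hgmeas : AEStronglyMeasurable g ν := by
    rw [hg, linearCombination_apply, Finsupp.sum]
    fun_prop
  obtain ⟨hFg, hFg0⟩ := integral_mul_linearCombination_cexp2pi_eq_zero hF h0 c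
  calc ‖∫ t, F t * H t ∂ν‖ₑ = ‖∫ t, F t * (H - g) t ∂ν‖ₑ := by
        simp only [Pi.sub_apply, mul_sub]
        rw [integral_sub hFH hFg, hFg0, sub_zero]
    _ ≤ eLpNorm (H - g) 1 ρ :=
        enorm_integral_mul_le hF.1 (hH.aestronglyMeasurable.sub hgmeas)
    _ ≤ ε := hc

end FourierUniqueness

section DiscreteFourier

variable {M : Type*} [AddCommGroup M] {P : ℕ}

theorem sum_range_add_of_periodic {g : ℤ → M} (hg : Function.Periodic g P) (a : ℤ) :
    ∑ k ∈ Finset.range P, g (k + a) = ∑ k ∈ Finset.range P, g k := by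
  have hsucc (a : ℤ) :
      ∑ k ∈ Finset.range P, g (k + (a + 1)) = ∑ k ∈ Finset.range P, g (k + a) := by
    have h := (Finset.sum_range_succ' (fun k : ℕ => g (k + a)) P).symm.trans
      (Finset.sum_range_succ _ P)
    have hP : g ((P : ℕ) + a) = g ((0 : ℕ) + a) := by
      rw [Nat.cast_zero, zero_add, add_comm, hg]
    rw [hP, add_left_inj] at h
    simpa only [Nat.cast_succ, add_assoc, add_comm (1 : ℤ)] using h
  induction a using Int.induction_on with
  | zero => simp only [add_zero]
  | succ a ih => rw [hsucc, ih]
  | pred a ih => rw [← ih, ← hsucc, sub_add_cancel]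

theorem sum_range_sub_of_periodic {g : ℤ → M} (hg : Function.Periodic g P) (a : ℤ) :
    ∑ k ∈ Finset.range P, g (a - k) = ∑ k ∈ Finset.range P, g k := by
  rw [← Finset.sum_range_reflect, ← sum_range_add_of_periodic hg (a - P + 1)]
  refine Finset.sum_congr rfl fun k hk => congrArg g ?_
  have := Finset.mem_range.1 hk
  omega

theorem sum_range_cexp2pi [NeZero P] (l : ℤ) :
    ∑ k ∈ Finset.range P, cexp2pi (k * (l / P)) = if (P : ℤ) ∣ l then (P : ℂ) else 0 := by
  have hP : (P : ℝ) ≠ 0 := NeZero.ne _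
  have hone : cexp2pi (l / P) = 1 ↔ (P : ℤ) ∣ l := by
    simp only [cexp2pi_eq_one_iff, div_eq_iff hP, mul_comm _ (P : ℝ), dvd_def]
    norm_cast
  simp only [cexp2pi_natCast_mul]
  split_ifs with h
  · simp [hone.2 h]
  · rw [geom_sum_eq (mt hone.1 h), ← cexp2pi_natCast_mul, mul_div_cancel₀ _ hP, cexp2pi_intCast,
      sub_self, zero_div]

theorem sum_range_ite_dvd_sub [NeZero P] {r : ℤ → M} (hr : Function.Periodic r P) (m : ℤ) :
    ∑ j ∈ Finset.range P, (if (P : ℤ) ∣ m - j then r j else 0) = r m := by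
  have hg : Function.Periodic (fun k : ℤ => if (P : ℤ) ∣ k then r m else 0) P := fun k => by
    simp only [dvd_add_self_right]
  calc ∑ j ∈ Finset.range P, (if (P : ℤ) ∣ m - j then r j else 0)
      = ∑ j ∈ Finset.range P, (if (P : ℤ) ∣ m - j then r m else 0) := by
        refine Finset.sum_congr rfl fun j _ => if_ctx_congr Iff.rfl (fun ⟨l, hl⟩ => ?_) fun _ => rfl
        rw [sub_eq_iff_eq_add'.1 hl, mul_comm]
        exact (hr.int_mul l j).symm
    _ = ∑ j ∈ Finset.range P, (if (P : ℤ) ∣ j then r m else 0) :=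
        sum_range_sub_of_periodic hg m
    _ = r m := by
        rw [Finset.sum_eq_single_of_mem 0 (Finset.mem_range.2 (NeZero.pos P)) fun j hj hj0 =>
          if_neg (mt Int.natCast_dvd_natCast.1 (Nat.not_dvd_of_pos_of_lt
            (Nat.pos_of_ne_zero hj0) (Finset.mem_range.1 hj)))]
        simp

theorem dft_inversion [NeZero P] {r : ℤ → ℂ} (hr : Function.Periodic r P) (m : ℤ) :
    r m = ∑ k ∈ Finset.range P, cexp2pi (k * m / P) *
      (1 / P * ∑ j ∈ Finset.range P, r j * cexp2pi (-(k * j / P))) := by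
  have hP : (P : ℂ) ≠ 0 := NeZero.ne _
  calc r m = ∑ j ∈ Finset.range P, (if (P : ℤ) ∣ m - j then r j else 0) :=
        (sum_range_ite_dvd_sub hr m).symm
    _ = ∑ j ∈ Finset.range P, 1 / P * r j *
          ∑ k ∈ Finset.range P, cexp2pi (k * ((m - j : ℤ) / P)) := by
        refine Finset.sum_congr rfl fun j _ => ?_
        rw [sum_range_cexp2pi, mul_ite, mul_zero]
        field_simp
    _ = _ := by
        simp only [Finset.mul_sum]
        rw [Finset.sum_comm]
        refine Finset.sum_congr rfl fun k _ => Finset.sum_congr rfl fun j _ => ?_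
        have : (k * ((m - j : ℤ) / P) : ℝ) = k * m / P + -(k * j / P) := by push_cast; ring
        rw [this, cexp2pi_add]
        ring

end DiscreteFourier

section SubBands

variable (P : ℕ) [NeZero P]

theorem ae_band_shift {p : ℝ → Prop} (h : ∀ᵐ f ∂(volume.restrict (Set.Ico (0 : ℝ) 1)), p f)
    (q : Fin P) : ∀ᵐ σ ∂(band P), p (σ + (q.val : ℝ) / P) := by
  have hP : (0 : ℝ) < P := Nat.cast_pos.2 (NeZero.pos P)
  have hq : (q.val : ℝ) + 1 ≤ P := by exact_mod_cast q.2
  rw [ae_restrict_iff' measurableSet_Ico] at h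
  rw [band, ae_restrict_iff' measurableSet_Ico]
  filter_upwards [(measurePreserving_add_right volume
    ((q.val : ℝ) / P)).quasiMeasurePreserving.ae h] with σ hσ hmem
  refine hσ ⟨add_nonneg hmem.1 (by positivity), ?_⟩
  calc σ + (q.val : ℝ) / P < 1 / P + q.val / P := by gcongr; exact hmem.2
    _ = (q.val + 1) / P := by ring
    _ ≤ 1 := (div_le_one hP).2 hq

theorem integrable_band_shift {F : ℝ → ℂ} (hF : IntegrableOn F (Set.Ico (0 : ℝ) 1)) (q : Fin P) :
    Integrable (fun σ => F (σ + (q.val : ℝ) / P)) (band P) := by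
  have hind := (hF.integrable_indicator measurableSet_Ico).comp_add_right ((q.val : ℝ) / P)
  exact (hind.mono_measure Measure.restrict_le_self).congr
    (ae_band_shift P (indicator_ae_eq_restrict measurableSet_Ico) q)

theorem integral_Ico_eq_sum_band {F : ℝ → ℂ} (hF : IntegrableOn F (Set.Ico (0 : ℝ) 1)) :
    ∫ f in Set.Ico (0 : ℝ) 1, F f = ∑ q : Fin P, ∫ σ, F (σ + (q.val : ℝ) / P) ∂(band P) := by
  have hP : (0 : ℝ) < P := Nat.cast_pos.2 (NeZero.pos P)
  have hint : IntervalIntegrable F volume 0 1 :=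
    (intervalIntegrable_iff_integrableOn_Ico_of_le zero_le_one).2 hF
  have hsub (k : ℕ) (hk : k < P) :
      IntervalIntegrable F volume ((k : ℝ) / P) ((k + 1 : ℕ) / P) := by
    refine hint.mono_set ?_
    rw [Set.uIcc_of_le zero_le_one, Set.uIcc_of_le (by gcongr; simp)]
    refine Set.Icc_subset_Icc (by positivity) ((div_le_one hP).2 ?_)
    exact_mod_cast hk
  have hsum := intervalIntegral.sum_integral_adjacent_intervals hsub
  simp only [Nat.cast_zero, zero_div, div_self hP.ne'] at hsum
  rw [integral_Ico_eq_integral_Ioc, ← intervalIntegral.integral_of_le zero_le_one, ← hsum,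
    ← Fin.sum_univ_eq_sum_range fun k => ∫ x in (k : ℝ) / P..((k + 1 : ℕ) : ℝ) / P, F x]
  refine Finset.sum_congr rfl fun q _ => ?_
  rw [band, integral_Ico_eq_integral_Ioc, ← intervalIntegral.integral_of_le (by positivity),
    intervalIntegral.integral_comp_add_right]
  congr 1
  · simp
  · push_cast; ring

end SubBands

theorem clBasis_dotProduct_cycMat_mulVec_star {P : ℕ} (S : ℤ → ℝ → ℂ) (n m : ℤ) (σ : ℝ) :
    clBasis P n σ ⬝ᵥ (cycMat P S σ *ᵥ star (clBasis P m σ)) =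
      ∑ q : Fin P, ∑ c : Fin P, S (q - c) (σ + q.val / P) *
        cexp2pi ((q.val - c.val : ℤ) * m / P + (σ + q.val / P) * (n - m : ℤ)) := by
  simp only [dotProduct, Matrix.mulVec, Finset.mul_sum, clBasis, cycMat, Matrix.of_apply,
    Pi.star_apply, RCLike.star_def, conj_cexp2pi]
  refine Finset.sum_congr rfl fun q _ => Finset.sum_congr rfl fun c _ => ?_
  rw [mul_left_comm, ← cexp2pi_add]
  congr 2
  push_cast
  ring

namespace IsCyclicSpectrum

variable {P : ℕ} {r r' : ℤ → ℤ → ℂ} {S S' : ℤ → ℝ → ℂ}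

theorem sub (h : IsCyclicSpectrum P r S) (h' : IsCyclicSpectrum P r' S') :
    IsCyclicSpectrum P (r - r') (S - S') := by
  refine ⟨fun k => (h.1 k).sub (h'.1 k), fun k m => ?_⟩
  simp only [Pi.sub_apply, sub_mul, Finset.sum_sub_distrib, mul_sub]
  rw [h.2, h'.2, integral_sub (integrable_mul_cexp2pi (h.1 k) (by fun_prop))
    (integrable_mul_cexp2pi (h'.1 k) (by fun_prop))]

theorem ae_unique (h : IsCyclicSpectrum P r S) (h' : IsCyclicSpectrum P r S') (k : ℤ) :
    ∀ᵐ f ∂(volume.restrict (Set.Ico (0 : ℝ) 1)), S k f = S' k f := by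
  have : Fact (0 < (1 : ℝ)) := ⟨one_pos⟩
  have hsub := h.sub h'
  filter_upwards [ae_eq_zero_of_integral_mul_cexp2pi_eq_zero
    (ae_restrict_mem measurableSet_Ico) (hsub.1 k) fun m => by
      simp only [div_one, mul_comm (m : ℝ), ← hsub.2 k m, sub_self, Pi.zero_apply, zero_mul,
        Finset.sum_const_zero, mul_zero]] with f hf
  exact sub_eq_zero.1 hf

variable [NeZero P]

theorem ae_periodic (h : IsCyclicSpectrum P r S) :
    ∀ᵐ f ∂(volume.restrict (Set.Ico (0 : ℝ) 1)), Function.Periodic (fun k => S k f) P := by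
  have hP : (P : ℝ) ≠ 0 := NeZero.ne _
  have hshift : IsCyclicSpectrum P r fun k => S (k + P) := by
    refine ⟨fun k => h.1 _, fun k m => ?_⟩
    rw [← h.2]
    congr! 3 with n
    rw [← cexp2pi_add_intCast _ (-n)]
    congr 1
    push_cast
    field_simp
    ring
  filter_upwards [ae_all_iff.2 (hshift.ae_unique h)] with f hf using hf

theorem integrable_cycMat (h : IsCyclicSpectrum P r S) (i j : Fin P) :
    Integrable (fun σ => cycMat P S σ i j) (band P) :=
  integrable_band_shift P (h.1 _) i

theorem cycMat_ae_eq (h : IsCyclicSpectrum P r S) (h' : IsCyclicSpectrum P r S') :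
    cycMat P S =ᵐ[band P] cycMat P S' := by
  filter_upwards [ae_all_iff.2 fun i => ae_band_shift P (ae_all_iff.2 (h.ae_unique h')) i]
    with σ hσ
  ext i j
  exact hσ i _

theorem eq_integral_sum (h : IsCyclicSpectrum P r S)
    (hr : ∀ m, Function.Periodic (fun n => r n m) P) (n m : ℤ) :
    r n m = ∫ f in Set.Ico (0 : ℝ) 1,
      ∑ k ∈ Finset.range P, S k f * cexp2pi (k * n / P + f * m) := by
  rw [integral_finsetSum _ fun (k : ℕ) _ => integrable_mul_cexp2pi (h.1 k) (by fun_prop),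
    dft_inversion (hr m) n]
  refine Finset.sum_congr rfl fun k _ => ?_
  have hk := h.2 k m
  rw [Int.cast_natCast] at hk
  rw [hk, ← integral_const_mul]
  refine integral_congr_ae (ae_of_all _ fun f => ?_)
  simp only [cexp2pi_add, mul_left_comm]

theorem ae_periodic_mul_cexp2pi (h : IsCyclicSpectrum P r S) (m l : ℤ) :
    ∀ᵐ f ∂(volume.restrict (Set.Ico (0 : ℝ) 1)),
      Function.Periodic (fun k : ℤ => S k f * cexp2pi (k * m / P + f * l)) P := by
  have hP : (P : ℝ) ≠ 0 := NeZero.ne _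
  filter_upwards [h.ae_periodic] with f hf k
  have hcexp : cexp2pi ((k + P : ℤ) * m / P + f * l) = cexp2pi (k * m / P + f * l) := by
    rw [← cexp2pi_add_intCast _ (-m)]
    congr 1
    push_cast
    field_simp
    ring
  simp only [hcexp, hf k]

theorem moment (h : IsCyclicSpectrum P r S) (hr : ∀ m, Function.Periodic (fun n => r n m) P)
    (n m : ℤ) :
    r m (n - m) = ∫ σ, clBasis P n σ ⬝ᵥ (cycMat P S σ *ᵥ star (clBasis P m σ)) ∂(band P) := by
  let G (f : ℝ) (k : ℤ) : ℂ := S k f * cexp2pi (k * m / P + f * (n - m : ℤ))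
  have hG (k : ℤ) : IntegrableOn (fun f => G f k) (Set.Ico 0 1) :=
    integrable_mul_cexp2pi (h.1 k) (by fun_prop)
  have hband (q : Fin P) : ∀ᵐ σ ∂(band P),
      ∑ k ∈ Finset.range P, G (σ + (q.val : ℝ) / P) k =
        ∑ c : Fin P, G (σ + (q.val : ℝ) / P) (q - c) := by
    filter_upwards [ae_band_shift P (h.ae_periodic_mul_cexp2pi m (n - m)) q] with σ hσ
    rw [← sum_range_sub_of_periodic hσ q]
    exact (Fin.sum_univ_eq_sum_range (fun c => G (σ + (q.val : ℝ) / P) (q - c)) P).symm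
  have hr_eq : r m (n - m) = ∫ f in Set.Ico (0 : ℝ) 1, ∑ k ∈ Finset.range P, G f k := by
    simpa only [G, Int.cast_natCast] using h.eq_integral_sum hr m (n - m)
  rw [hr_eq, integral_Ico_eq_sum_band P (integrable_finsetSum _ fun (k : ℕ) _ => hG k),
    Finset.sum_congr rfl fun q _ => integral_congr_ae (hband q),
    ← integral_finsetSum _ fun (q : Fin P) _ => integrable_finsetSum _ fun (c : Fin P) _ =>
      integrable_band_shift P (hG (q - c)) q]
  exact integral_congr_ae (ae_of_all _ fun σ =>
    (clBasis_dotProduct_cycMat_mulVec_star S n m σ).symm)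

end IsCyclicSpectrum

section CramerLoeveBasis

variable {P : ℕ}

instance isFiniteMeasure_band : IsFiniteMeasure (band P) :=
  inferInstanceAs (IsFiniteMeasure (volume.restrict (Set.Ico (0 : ℝ) (1 / P))))

@[fun_prop]
theorem continuous_clBasis (n : ℤ) : Continuous (clBasis P n) :=
  continuous_pi fun q => continuous_cexp2pi.comp (by fun_prop)

theorem norm_clBasis_apply (n : ℤ) (σ : ℝ) (q : Fin P) : ‖clBasis P n σ q‖ = 1 :=
  norm_cexp2pi _

theorem norm_clBasis_le (n : ℤ) (σ : ℝ) : ‖clBasis P n σ‖ ≤ 1 :=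
  (pi_norm_le_iff_of_nonneg zero_le_one).2 fun _ => (norm_clBasis_apply n σ _).le

theorem memLp_clBasis (p : ℝ≥0∞) (n : ℤ) : MemLp (clBasis P n) p (band P) :=
  .of_bound (by fun_prop) 1 (Eventually.of_forall (norm_clBasis_le n))

theorem memLp_linearCombination_clBasis (p : ℝ≥0∞) (c : ℤ →₀ ℂ) :
    MemLp (linearCombination ℂ (clBasis P) c) p (band P) := by
  rw [linearCombination_apply]
  exact memLp_finsetSum' _ fun n _ => (memLp_clBasis p n).const_smul _

variable {p : ℝ≥0∞} {ρ : Measure ℝ}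

theorem memLp_dotProduct_star_clBasis {h : ℝ → Fin P → ℂ} (hh : MemLp h p ρ) (n : ℤ) :
    MemLp (fun σ => h σ ⬝ᵥ star (clBasis P n σ)) p ρ := by
  refine memLp_finsetSum _ fun q _ => (MemLp.eval hh q).mono ((MemLp.eval hh q).1.mul ?_) ?_
  · exact ((continuous_apply q).comp (continuous_clBasis n)).star.aestronglyMeasurable
  · exact Eventually.of_forall fun σ => by simp [norm_clBasis_apply]

theorem eLpNorm_sum_smul_clBasis_le (hp : 1 ≤ p) (s : Finset ℕ) {r : ℕ → ℝ → ℂ}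
    (hr : ∀ l, AEStronglyMeasurable (r l) ρ) :
    eLpNorm (∑ l ∈ s, fun σ => r l σ • clBasis P l σ) p ρ ≤ ∑ l ∈ s, eLpNorm (r l) p ρ := by
  refine (eLpNorm_sum_le (fun l _ => (hr l).smul (by fun_prop)) hp).trans
    (Finset.sum_le_sum fun l _ => eLpNorm_mono fun σ => ?_)
  rw [Pi.smul_apply', norm_smul]
  exact mul_le_of_le_one_right (norm_nonneg _) (norm_clBasis_le l σ)

variable [NeZero P]

theorem sum_clBasis_mul_conj_clBasis (σ : ℝ) (q j : Fin P) :
    ∑ l ∈ Finset.range P, clBasis P l σ q * conj (clBasis P l σ j) =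
      if q = j then (P : ℂ) else 0 := by
  have hdvd : (P : ℤ) ∣ q - j ↔ q = j := by
    refine ⟨fun h => ?_, fun h => by simp [h]⟩
    have := Int.eq_zero_of_abs_lt_dvd h (by rw [abs_lt]; omega)
    omega
  simp only [← hdvd, ← sum_range_cexp2pi, clBasis, conj_cexp2pi, ← cexp2pi_add]
  refine Finset.sum_congr rfl fun l _ => congrArg cexp2pi ?_
  push_cast
  ring

theorem sum_dotProduct_smul_clBasis (u : Fin P → ℂ) (σ : ℝ) :
    ∑ l ∈ Finset.range P, (1 / P * (u ⬝ᵥ star (clBasis P l σ))) • clBasis P l σ = u := by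
  have hP : (P : ℂ) ≠ 0 := NeZero.ne _
  ext q
  simp only [Finset.sum_apply, Pi.smul_apply, smul_eq_mul, dotProduct, Finset.mul_sum,
    Finset.sum_mul]
  rw [Finset.sum_comm]
  calc ∑ j, ∑ l ∈ Finset.range P, 1 / P * (u j * star (clBasis P l σ) j) * clBasis P l σ q
      = ∑ j, 1 / P * u j *
          ∑ l ∈ Finset.range P, clBasis P l σ q * conj (clBasis P l σ j) := by
        simp only [Finset.mul_sum]
        refine Finset.sum_congr rfl fun j _ => Finset.sum_congr rfl fun l _ => ?_
        simp only [Pi.star_apply, RCLike.star_def]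
        ring
    _ = u q := by
        simp only [sum_clBasis_mul_conj_clBasis, mul_ite, mul_zero, Finset.sum_ite_eq,
          Finset.mem_univ, if_true]
        field_simp

theorem clBasis_mul_add (n l : ℤ) (σ : ℝ) :
    clBasis P (n * P + l) σ = cexp2pi (n * σ / (1 / P)) • clBasis P l σ := by
  have hP : (P : ℝ) ≠ 0 := NeZero.ne _
  ext q
  rw [Pi.smul_apply, smul_eq_mul, clBasis, clBasis, ← cexp2pi_add,
    ← cexp2pi_add_intCast (_ + _) (n * q)]
  congr 1
  push_cast
  field_simp
  ring

theorem linearCombination_clBasis_mapDomain (c : ℤ →₀ ℂ) (l : ℤ) (σ : ℝ) :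
    linearCombination ℂ (clBasis P) (c.mapDomain fun n => n * P + l) σ =
      linearCombination ℂ (fun (n : ℤ) t => cexp2pi (n * t / (1 / P))) c σ • clBasis P l σ := by
  rw [Finsupp.linearCombination_mapDomain, linearCombination_apply, linearCombination_apply]
  simp only [Finsupp.sum, Function.comp_apply, Finset.sum_apply, Pi.smul_apply, clBasis_mul_add,
    Finset.sum_smul, smul_assoc]

theorem exists_eLpNorm_sub_clBasis_le [Fact (1 ≤ p)] (hp : p ≠ ∞) [IsFiniteMeasure ρ]
    (hρ : ρ ≪ band P) {h : ℝ → Fin P → ℂ} (hh : MemLp h p ρ) {ε : ℝ≥0∞} (hε : ε ≠ 0) :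
    ∃ c : ℤ →₀ ℂ, eLpNorm (h - linearCombination ℂ (clBasis P) c) p ρ ≤ ε := by
  have : Fact (0 < (1 / P : ℝ)) := ⟨one_div_pos.2 (Nat.cast_pos.2 (NeZero.pos P))⟩
  let g (l : ℕ) (σ : ℝ) : ℂ := 1 / P * (h σ ⬝ᵥ star (clBasis P l σ))
  have hg (l : ℕ) : MemLp (g l) p ρ := (memLp_dotProduct_star_clBasis hh l).const_mul _
  choose c hc using fun l => exists_eLpNorm_sub_cexp2pi_le ρ
    (hρ.ae_le (ae_restrict_mem measurableSet_Ico)) hp (hg l)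
    (ENNReal.div_ne_zero.2 ⟨hε, ENNReal.natCast_ne_top P⟩)
  let t (l : ℕ) : ℝ → ℂ := linearCombination ℂ (fun (n : ℤ) t => cexp2pi (n * t / (1 / P))) (c l)
  have ht (l : ℕ) : Continuous (t l) := by
    simp only [t, linearCombination_apply]
    exact Finset.sum_induction _ Continuous (fun _ _ => .add) continuous_zero fun n _ => by fun_prop
  refine ⟨∑ l ∈ Finset.range P, (c l).mapDomain fun n => n * P + l, ?_⟩
  have hexpand : h - linearCombination ℂ (clBasis P)
      (∑ l ∈ Finset.range P, (c l).mapDomain fun n => n * P + l) =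
        ∑ l ∈ Finset.range P, fun σ => (g l - t l) σ • clBasis P l σ := by
    ext1 σ
    simp only [map_sum, Pi.sub_apply, Finset.sum_apply, linearCombination_clBasis_mapDomain,
      sub_smul, Finset.sum_sub_distrib, g, t, sum_dotProduct_smul_clBasis]
  calc eLpNorm (h - linearCombination ℂ (clBasis P) _) p ρ
      ≤ ∑ l ∈ Finset.range P, eLpNorm (g l - t l) p ρ := by
        rw [hexpand]
        exact eLpNorm_sum_smul_clBasis_le Fact.out _ fun l =>
          (hg l).1.sub (ht l).aestronglyMeasurable
    _ ≤ ∑ _l ∈ Finset.range P, ε / P := Finset.sum_le_sum fun l _ => hc l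
    _ = ε := by
        rw [Finset.sum_const, Finset.card_range, nsmul_eq_mul,
          ENNReal.mul_div_cancel (NeZero.ne _) (ENNReal.natCast_ne_top P)]

end CramerLoeveBasis

section EntryMeasure

variable {α n : Type*} [MeasurableSpace α] [Fintype n] {ν : Measure α} {K : α → Matrix n n ℂ}
  {u v : α → n → ℂ}

theorem enorm_dotProduct_mulVec_star_le (M : Matrix n n ℂ) (a b : n → ℂ) :
    ‖a ⬝ᵥ (M *ᵥ star b)‖ₑ ≤ (∑ i, ∑ j, ‖M i j‖ₑ) * (‖a‖ₑ * ‖b‖ₑ) := by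
  have apply_le (c : n → ℂ) (i : n) : ‖c i‖ₑ ≤ ‖c‖ₑ := by
    simpa only [enorm_eq_nnnorm, ENNReal.coe_le_coe] using nnnorm_le_pi_nnnorm c i
  simp only [dotProduct, Matrix.mulVec, Finset.mul_sum, Finset.sum_mul]
  refine (enorm_sum_le _ _).trans (Finset.sum_le_sum fun i _ =>
    (enorm_sum_le _ _).trans (Finset.sum_le_sum fun j _ => ?_))
  calc ‖a i * (M i j * star b j)‖ₑ = ‖M i j‖ₑ * (‖a i‖ₑ * ‖b j‖ₑ) := by
        rw [enorm_mul, enorm_mul, Pi.star_apply, RCLike.star_def, RCLike.enorm_conj, mul_left_comm]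
    _ ≤ ‖M i j‖ₑ * (‖a‖ₑ * ‖b‖ₑ) := by gcongr <;> apply apply_le

theorem aestronglyMeasurable_dotProduct_mulVec_star
    (hK : ∀ i j, AEStronglyMeasurable (K · i j) ν) (hu : AEStronglyMeasurable u ν)
    (hv : AEStronglyMeasurable v ν) :
    AEStronglyMeasurable (fun σ => u σ ⬝ᵥ (K σ *ᵥ star (v σ))) ν := by
  have apply {w : α → n → ℂ} (hw : AEStronglyMeasurable w ν) (i : n) :
      AEStronglyMeasurable (fun σ => w σ i) ν := (continuous_apply i).comp_aestronglyMeasurable hw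
  exact Finset.aestronglyMeasurable_fun_sum _ fun i _ => (apply hu i).mul <|
    Finset.aestronglyMeasurable_fun_sum _ fun j _ => (hK i j).mul (apply hv j).star

/-- The measure whose density is the entrywise `ℓ¹` norm of `K`. Its `L²` norm dominates the
sesquilinear form `∫ u K v^*`, whether or not `K` is positive semidefinite. -/
def entryMeasure (ν : Measure α) (K : α → Matrix n n ℂ) : Measure α :=
  ν.withDensity fun σ => ∑ i, ∑ j, ‖K σ i j‖ₑ

theorem entryMeasure_absolutelyContinuous : entryMeasure ν K ≪ ν :=
  withDensity_absolutelyContinuous _ _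

theorem isFiniteMeasure_entryMeasure (hK : ∀ i j, Integrable (K · i j) ν) :
    IsFiniteMeasure (entryMeasure ν K) := by
  have hm (i j) : AEMeasurable (fun σ => ‖K σ i j‖ₑ) ν := (hK i j).1.enorm
  refine isFiniteMeasure_withDensity ?_
  simp only [lintegral_finsetSum' _ fun i _ => Finset.aemeasurable_fun_sum _ fun j _ => hm i j,
    lintegral_finsetSum' _ fun j _ => hm _ j]
  exact ENNReal.sum_ne_top.2 fun i _ => ENNReal.sum_ne_top.2 fun j _ => (hK i j).2.ne

theorem memLp_entryMeasure (hK : ∀ i j, Integrable (K · i j) ν) (hu : MemLp u ∞ ν) (p : ℝ≥0∞) :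
    MemLp u p (entryMeasure ν K) := by
  have := isFiniteMeasure_entryMeasure hK
  have hu_top : eLpNorm u ∞ (entryMeasure ν K) ≤ eLpNorm u ∞ ν := by
    simpa only [eLpNorm_exponent_top] using
      eLpNormEssSup_mono_measure u entryMeasure_absolutelyContinuous
  exact MemLp.mono_exponent (q := ∞)
    ⟨hu.1.mono_ac entryMeasure_absolutelyContinuous, hu_top.trans_lt hu.2⟩ le_top

theorem lintegral_enorm_dotProduct_mulVec_star_le (hK : ∀ i j, AEStronglyMeasurable (K · i j) ν)
    (hu : AEStronglyMeasurable u ν) (hv : AEStronglyMeasurable v ν) :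
    ∫⁻ σ, ‖u σ ⬝ᵥ (K σ *ᵥ star (v σ))‖ₑ ∂ν ≤
      eLpNorm u 2 (entryMeasure ν K) * eLpNorm v 2 (entryMeasure ν K) := by
  have hm : AEMeasurable (fun σ => ∑ i, ∑ j, ‖K σ i j‖ₑ) ν :=
    Finset.aemeasurable_fun_sum _ fun i _ => Finset.aemeasurable_fun_sum _ fun j _ => (hK i j).enorm
  have hu' := hu.mono_ac (entryMeasure_absolutelyContinuous (K := K))
  have hv' := hv.mono_ac (entryMeasure_absolutelyContinuous (K := K))
  calc ∫⁻ σ, ‖u σ ⬝ᵥ (K σ *ᵥ star (v σ))‖ₑ ∂ν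
      ≤ ∫⁻ σ, (∑ i, ∑ j, ‖K σ i j‖ₑ) * (‖u σ‖ₑ * ‖v σ‖ₑ) ∂ν :=
        lintegral_mono fun σ => enorm_dotProduct_mulVec_star_le _ _ _
    _ = ∫⁻ σ, ‖u σ‖ₑ * ‖v σ‖ₑ ∂(entryMeasure ν K) :=
        (lintegral_withDensity_eq_lintegral_mul₀ hm (hu.enorm.mul hv.enorm)).symm
    _ ≤ eLpNorm u 2 (entryMeasure ν K) * eLpNorm v 2 (entryMeasure ν K) := by
        simpa [eLpNorm_eq_lintegral_rpow_enorm_toReal] using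
          ENNReal.lintegral_mul_le_Lp_mul_Lq _ .two_two hu'.enorm hv'.enorm

theorem integrable_dotProduct_mulVec_star (hK : ∀ i j, Integrable (K · i j) ν)
    (hu : MemLp u ∞ ν) (hv : MemLp v ∞ ν) :
    Integrable (fun σ => u σ ⬝ᵥ (K σ *ᵥ star (v σ))) ν :=
  ⟨aestronglyMeasurable_dotProduct_mulVec_star (fun i j => (hK i j).1) hu.1 hv.1,
    (lintegral_enorm_dotProduct_mulVec_star_le (fun i j => (hK i j).1) hu.1 hv.1).trans_lt
      (ENNReal.mul_lt_top (memLp_entryMeasure hK hu 2).2 (memLp_entryMeasure hK hv 2).2)⟩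

theorem tendsto_integral_dotProduct_mulVec_star (hK : ∀ i j, Integrable (K · i j) ν)
    (hu : MemLp u ∞ ν) {w : ℕ → α → n → ℂ} (hw : ∀ k, MemLp (w k) ∞ ν)
    (hwu : Tendsto (fun k => eLpNorm (u - w k) 2 (entryMeasure ν K)) atTop (𝓝 0)) :
    Tendsto (fun k => ∫ σ, w k σ ⬝ᵥ (K σ *ᵥ star (w k σ)) ∂ν) atTop
      (𝓝 (∫ σ, u σ ⬝ᵥ (K σ *ᵥ star (u σ)) ∂ν)) := by
  have hKm (i j) := (hK i j).1
  let U := eLpNorm u 2 (entryMeasure ν K)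
  let E (k : ℕ) := eLpNorm (u - w k) 2 (entryMeasure ν K)
  have hd (k : ℕ) : MemLp (u - w k) ∞ ν := hu.sub (hw k)
  have hle (k : ℕ) : ∫⁻ σ, ‖w k σ ⬝ᵥ (K σ *ᵥ star (w k σ)) - u σ ⬝ᵥ (K σ *ᵥ star (u σ))‖ₑ ∂ν ≤
      (U + E k) * E k + E k * U := by
    have hw_le : eLpNorm (w k) 2 (entryMeasure ν K) ≤ U + E k := by
      simpa only [sub_sub_cancel] using eLpNorm_sub_le (memLp_entryMeasure hK hu 2).1
        (memLp_entryMeasure hK (hd k) 2).1 one_le_two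
    calc _ = ∫⁻ σ, ‖w k σ ⬝ᵥ (K σ *ᵥ star ((u - w k) σ)) +
            (u - w k) σ ⬝ᵥ (K σ *ᵥ star (u σ))‖ₑ ∂ν := by
          refine lintegral_congr fun σ => ?_
          rw [← enorm_neg]
          simp only [Pi.sub_apply, star_sub, Matrix.mulVec_sub, sub_dotProduct, dotProduct_sub]
          ring_nf
      _ ≤ eLpNorm (w k) 2 (entryMeasure ν K) * E k + E k * U :=
          ((lintegral_mono fun σ => enorm_add_le _ _).trans_eq (lintegral_enorm_add_left
            (integrable_dotProduct_mulVec_star hK (hw k) (hd k)).1 _)).trans (add_le_add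
              (lintegral_enorm_dotProduct_mulVec_star_le hKm (hw k).1 (hd k).1)
              (lintegral_enorm_dotProduct_mulVec_star_le hKm (hd k).1 hu.1))
      _ ≤ (U + E k) * E k + E k * U := by gcongr
  have hU : U ≠ ∞ := (memLp_entryMeasure hK hu 2).2.ne
  have hlim : Tendsto (fun k => (U + E k) * E k + E k * U) atTop (𝓝 0) := by
    have := (ENNReal.Tendsto.mul (hwu.const_add U) (by simp) hwu (by simp [hU])).add
      (ENNReal.Tendsto.mul_const (b := U) hwu (.inr hU))
    simpa using this
  refine tendsto_integral_of_L1 _ (integrable_dotProduct_mulVec_star hK hu hu).1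
    (Eventually.of_forall fun k => integrable_dotProduct_mulVec_star hK (hw k) (hw k))
    (tendsto_of_tendsto_of_tendsto_of_le_of_le tendsto_const_nhds hlim (fun _ => zero_le) hle)

end EntryMeasure

theorem posSemidef_of_dotProduct_mulVec_star_nonneg {n : Type*} [Fintype n] {M : Matrix n n ℂ}
    (h : ∀ v : n → ℂ, 0 ≤ v ⬝ᵥ (M *ᵥ star v)) : M.PosSemidef := by
  classical
  have h' (v : n → ℂ) : 0 ≤ star v ⬝ᵥ (M *ᵥ v) := by simpa using h (star v)
  refine .of_dotProduct_mulVec_nonneg ?_ h'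
  rw [← Matrix.isSymmetric_toEuclideanLin_iff, LinearMap.isSymmetric_iff_inner_map_self_real]
  intro v
  rw [Complex.conj_eq_iff_im, ← inner_conj_symm, Complex.conj_im, neg_eq_zero,
    EuclideanSpace.inner_eq_star_dotProduct, dotProduct_comm]
  exact (Complex.nonneg_iff.1 (h' _)).2.symm

section PosSemidef

variable {P : ℕ} [NeZero P] {K : ℝ → Matrix (Fin P) (Fin P) ℂ}

theorem exists_tendsto_eLpNorm_sub_clBasis (hK : ∀ i j, Integrable (K · i j) (band P))
    {h : ℝ → Fin P → ℂ} (hh : MemLp h 2 (entryMeasure (band P) K)) :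
    ∃ c : ℕ → ℤ →₀ ℂ, Tendsto (fun k => eLpNorm (h - linearCombination ℂ (clBasis P) (c k)) 2
      (entryMeasure (band P) K)) atTop (𝓝 0) := by
  have := isFiniteMeasure_entryMeasure hK
  have : Fact ((1 : ℝ≥0∞) ≤ 2) := ⟨one_le_two⟩
  choose c hc using fun k : ℕ => exists_eLpNorm_sub_clBasis_le ENNReal.ofNat_ne_top
    entryMeasure_absolutelyContinuous hh (ENNReal.inv_ne_zero.2 (ENNReal.natCast_ne_top k))
  exact ⟨c, tendsto_of_tendsto_of_tendsto_of_le_of_le tendsto_const_nhds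
    ENNReal.tendsto_inv_nat_nhds_zero (fun _ => zero_le) hc⟩

theorem integral_dotProduct_mulVec_star_nonneg (hK : ∀ i j, Integrable (K · i j) (band P))
    (hpos : ∀ c : ℤ →₀ ℂ, 0 ≤ ∫ σ, linearCombination ℂ (clBasis P) c σ ⬝ᵥ
      (K σ *ᵥ star (linearCombination ℂ (clBasis P) c σ)) ∂(band P))
    {u : ℝ → Fin P → ℂ} (hu : MemLp u ∞ (band P)) :
    0 ≤ ∫ σ, u σ ⬝ᵥ (K σ *ᵥ star (u σ)) ∂(band P) := by
  obtain ⟨c, hc⟩ := exists_tendsto_eLpNorm_sub_clBasis hK (memLp_entryMeasure hK hu 2)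
  exact ge_of_tendsto' (tendsto_integral_dotProduct_mulVec_star hK hu
    (fun k => memLp_linearCombination_clBasis ∞ (c k)) hc) fun k => hpos (c k)

theorem ae_dotProduct_mulVec_star_nonneg (hK : ∀ i j, Integrable (K · i j) (band P))
    (hpos : ∀ c : ℤ →₀ ℂ, 0 ≤ ∫ σ, linearCombination ℂ (clBasis P) c σ ⬝ᵥ
      (K σ *ᵥ star (linearCombination ℂ (clBasis P) c σ)) ∂(band P)) (v : Fin P → ℂ) :
    ∀ᵐ σ ∂(band P), 0 ≤ v ⬝ᵥ (K σ *ᵥ star v) := by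
  have hi : Integrable (fun σ => v ⬝ᵥ (K σ *ᵥ star v)) (band P) :=
    integrable_dotProduct_mulVec_star hK (memLp_top_const v) (memLp_top_const v)
  have hset (A : Set ℝ) (hA : MeasurableSet A) : 0 ≤ ∫ σ in A, v ⬝ᵥ (K σ *ᵥ star v) ∂(band P) := by
    have := integral_dotProduct_mulVec_star_nonneg hK hpos ((memLp_top_const v).indicator hA)
    rw [← integral_indicator hA]
    convert this using 3 with σ
    by_cases hσ : σ ∈ A <;> simp [hσ]
  have hre := ae_nonneg_of_forall_setIntegral_nonneg hi.re fun A hA _ => by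
    rw [integral_re hi.integrableOn]
    exact (Complex.nonneg_iff.1 (hset A hA)).1
  have him := Integrable.ae_eq_zero_of_forall_setIntegral_eq_zero hi.im fun A hA _ => by
    rw [integral_im hi.integrableOn]
    exact (Complex.nonneg_iff.1 (hset A hA)).2.symm
  filter_upwards [hre, him] with σ hre him using Complex.nonneg_iff.2 ⟨hre, him.symm⟩

theorem ae_posSemidef_of_integral_nonneg (hK : ∀ i j, Integrable (K · i j) (band P))
    (hpos : ∀ c : ℤ →₀ ℂ, 0 ≤ ∫ σ, linearCombination ℂ (clBasis P) c σ ⬝ᵥ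
      (K σ *ᵥ star (linearCombination ℂ (clBasis P) c σ)) ∂(band P)) :
    ∀ᵐ σ ∂(band P), (K σ).PosSemidef := by
  have hdense : ∀ᵐ σ ∂(band P), ∀ k : ℕ, 0 ≤ TopologicalSpace.denseSeq (Fin P → ℂ) k ⬝ᵥ
      (K σ *ᵥ star (TopologicalSpace.denseSeq (Fin P → ℂ) k)) :=
    ae_all_iff.2 fun k => ae_dotProduct_mulVec_star_nonneg hK hpos _
  filter_upwards [hdense] with σ hσ
  have hclosed : IsClosed {v : Fin P → ℂ | 0 ≤ v ⬝ᵥ (K σ *ᵥ star v)} :=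
    isClosed_le continuous_const (by fun_prop)
  exact posSemidef_of_dotProduct_mulVec_star_nonneg fun v => hclosed.closure_subset_iff.2
    (Set.range_subset_iff.2 hσ) (TopologicalSpace.denseRange_denseSeq _ v)

end PosSemidef

section QuadraticForm

variable {n : Type*} [Fintype n] {K : Matrix n n ℂ}

/-- The quadratic form `∑_{r,c} u_r K_{r,c} u_c^*` of `HasSpectralIntegral`: the vector `u` is a
row, so this is the form of `K` at `star u` in Mathlib's convention. -/
def quad (K : Matrix n n ℂ) (u : n → ℂ) : ℝ := (u ⬝ᵥ (K *ᵥ star u)).re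

theorem re_dotProduct_mulVec_star_comm (hK : K.IsHermitian) (u v : n → ℂ) :
    (u ⬝ᵥ (K *ᵥ star v)).re = (v ⬝ᵥ (K *ᵥ star u)).re := by
  have h : star (u ⬝ᵥ (K *ᵥ star v)) = v ⬝ᵥ (K *ᵥ star u) := by
    rw [← Matrix.star_dotProduct_star, Matrix.star_mulVec, star_star, hK.eq,
      ← Matrix.dotProduct_mulVec]
  simpa using congrArg Complex.re h

theorem quad_nonneg (hK : K.PosSemidef) (u : n → ℂ) : 0 ≤ quad K u := by
  simpa [quad] using hK.re_dotProduct_nonneg (star u)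

theorem quad_sub (hK : K.IsHermitian) (u v : n → ℂ) :
    quad K (u - v) = quad K u - 2 * (u ⬝ᵥ (K *ᵥ star v)).re + quad K v := by
  have h := re_dotProduct_mulVec_star_comm hK u v
  simp only [quad, star_sub, Matrix.mulVec_sub, sub_dotProduct, dotProduct_sub, Complex.sub_re]
  linarith

theorem quad_sub_matrix (K L : Matrix n n ℂ) (u : n → ℂ) :
    quad (K - L) u = quad K u - quad L u := by
  simp [quad, Matrix.sub_mulVec, dotProduct_sub]

theorem quad_smul_one [DecidableEq n] (p : ℝ) (u : n → ℂ) :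
    quad ((p : ℂ) • (1 : Matrix n n ℂ)) u = p * ‖WithLp.toLp 2 u‖ ^ 2 := by
  rw [EuclideanSpace.norm_sq_eq, quad, Matrix.smul_mulVec, Matrix.one_mulVec, dotProduct_smul,
    smul_eq_mul, Complex.re_ofReal_mul, dotProduct, Complex.re_sum]
  simp only [Pi.star_apply, RCLike.star_def, Complex.mul_conj, Complex.ofReal_re,
    Complex.normSq_eq_norm_sq]

theorem quad_neg (K : Matrix n n ℂ) (u : n → ℂ) : quad K (-u) = quad K u := by
  simp [quad, Matrix.mulVec_neg]

theorem quad_smul (K : Matrix n n ℂ) (a : ℂ) (u : n → ℂ) :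
    quad K (a • u) = ‖a‖ ^ 2 * quad K u := by
  have : a * star a = ((‖a‖ ^ 2 : ℝ) : ℂ) := by
    rw [RCLike.star_def, Complex.mul_conj, Complex.normSq_eq_norm_sq]
  rw [quad, star_smul, Matrix.mulVec_smul, smul_dotProduct, dotProduct_smul, smul_smul, this,
    smul_eq_mul, Complex.re_ofReal_mul, quad]

theorem eq_zero_of_quad_eq_zero (hK : K.PosDef) {u : n → ℂ} (h : quad K u = 0) : u = 0 := by
  by_contra hu
  have := hK.re_dotProduct_pos (star_ne_zero.2 hu)
  simp only [star_star] at this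
  exact this.ne' h

open scoped MatrixOrder in
theorem sqrt_quad_add_le (hK : K.PosSemidef) (u v : n → ℂ) :
    √(quad K (u + v)) ≤ √(quad K u) + √(quad K v) := by
  classical
  obtain ⟨B, rfl⟩ := CStarAlgebra.nonneg_iff_eq_star_mul_self.mp hK.nonneg
  have h (w : n → ℂ) : √(quad (star B * B) w) = ‖WithLp.toLp 2 (B *ᵥ star w)‖ := by
    rw [norm_eq_sqrt_re_inner (𝕜 := ℂ), EuclideanSpace.inner_toLp_toLp, quad,
      Matrix.star_eq_conjTranspose, Matrix.star_mulVec, star_star, ← Matrix.mulVec_mulVec,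
      Matrix.dotProduct_mulVec, dotProduct_comm]
    rfl
  rw [h, h, h, star_add, Matrix.mulVec_add, WithLp.toLp_add]
  exact norm_add_le _ _

end QuadraticForm

section MatrixInverse

variable {n : Type*} [DecidableEq n] {X : Matrix n n ℂ} {p : ℝ}

theorem posDef_of_sub_smul_one_posSemidef (hp : 0 < p) (hX : (X - (p : ℂ) • 1).PosSemidef) :
    X.PosDef := by
  have h1 : ((p : ℂ) • (1 : Matrix n n ℂ)).PosDef := Matrix.PosDef.one.smul (by exact_mod_cast hp)
  simpa using h1.add_posSemidef hX

variable [Fintype n]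

theorem mul_norm_le_norm_mulVec (hX : (X - (p : ℂ) • 1).PosSemidef) (v : n → ℂ) :
    p * ‖WithLp.toLp 2 v‖ ≤ ‖WithLp.toLp 2 (X *ᵥ v)‖ := by
  have hstar : ‖WithLp.toLp 2 (star v)‖ = ‖WithLp.toLp 2 v‖ := by
    simp [EuclideanSpace.norm_eq]
  have hle : p * ‖WithLp.toLp 2 v‖ ^ 2 ≤ ‖WithLp.toLp 2 v‖ * ‖WithLp.toLp 2 (X *ᵥ v)‖ :=
    calc p * ‖WithLp.toLp 2 v‖ ^ 2 ≤ quad X (star v) := by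
          have := quad_nonneg hX (star v)
          rw [quad_sub_matrix, quad_smul_one, hstar] at this
          linarith
      _ = RCLike.re (inner ℂ (WithLp.toLp 2 v) (WithLp.toLp 2 (X *ᵥ v))) := by
          rw [EuclideanSpace.inner_eq_star_dotProduct, dotProduct_comm, quad, star_star]
          rfl
      _ ≤ ‖WithLp.toLp 2 v‖ * ‖WithLp.toLp 2 (X *ᵥ v)‖ := re_inner_le_norm _ _
  rcases (norm_nonneg (WithLp.toLp 2 v)).eq_or_lt' with h | h
  · simp [h]
  · exact le_of_mul_le_mul_left (by linarith) h

theorem norm_inv_apply_le (hp : 0 < p) (hX : (X - (p : ℂ) • 1).PosSemidef) (i j : n) :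
    ‖X⁻¹ i j‖ ≤ p⁻¹ := by
  have hdet := (Matrix.isUnit_iff_isUnit_det _).1 (posDef_of_sub_smul_one_posSemidef hp hX).isUnit
  have hcol := mul_norm_le_norm_mulVec hX (X⁻¹ *ᵥ Pi.single j 1)
  rw [Matrix.mulVec_mulVec, Matrix.mul_nonsing_inv _ hdet, Matrix.one_mulVec] at hcol
  have hij : X⁻¹ i j = WithLp.toLp 2 (X⁻¹ *ᵥ Pi.single j 1) i := by simp
  calc ‖X⁻¹ i j‖ ≤ ‖WithLp.toLp 2 (X⁻¹ *ᵥ Pi.single j 1)‖ := hij ▸ PiLp.norm_apply_le _ i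
    _ ≤ p⁻¹ := by
        rw [← one_div p, le_div_iff₀' hp]
        simpa using hcol

end MatrixInverse

/-- `A` and `X` are the spectral matrices of a signal and of its sum with an uncorrelated noise,
signal or noise being white of power `p`. -/
structure IsWhitePair {n : Type*} [DecidableEq n] (p : ℝ) (A X : Matrix n n ℂ) : Prop where
  pos : 0 < p
  posSemidef : A.PosSemidef
  sub_posSemidef : (X - A).PosSemidef
  white : A = (p : ℂ) • 1 ∨ X - A = (p : ℂ) • 1

namespace IsWhitePair

variable {n : Type*} [DecidableEq n] {p : ℝ} {A X : Matrix n n ℂ}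

theorem sub_smul_one_posSemidef (h : IsWhitePair p A X) : (X - (p : ℂ) • 1).PosSemidef := by
  rcases h.white with hw | hw
  · exact hw ▸ h.sub_posSemidef
  · rw [← hw, sub_sub_cancel]
    exact h.posSemidef

theorem posDef (h : IsWhitePair p A X) : X.PosDef :=
  posDef_of_sub_smul_one_posSemidef h.pos h.sub_smul_one_posSemidef

variable [Fintype n]

theorem isUnit_det (h : IsWhitePair p A X) : IsUnit X.det :=
  (Matrix.isUnit_iff_isUnit_det _).1 h.posDef.isUnit

theorem norm_mul_inv_apply_le (h : IsWhitePair p A X) (i j : n) : ‖(A * X⁻¹) i j‖ ≤ 2 := by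
  have hp : ‖((p : ℂ) • X⁻¹) i j‖ ≤ 1 := by
    rw [Matrix.smul_apply, norm_smul, Complex.norm_real, Real.norm_of_nonneg h.pos.le,
      ← mul_inv_cancel₀ h.pos.ne']
    exact mul_le_mul_of_nonneg_left (norm_inv_apply_le h.pos h.sub_smul_one_posSemidef i j) h.pos.le
  rcases h.white with hw | hw
  · rw [hw, Matrix.smul_mul, one_mul]
    linarith
  · have hinv : A * X⁻¹ = 1 - (p : ℂ) • X⁻¹ := by
      rw [← sub_sub_cancel X A, hw, Matrix.sub_mul, Matrix.mul_nonsing_inv _ h.isUnit_det,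
        Matrix.smul_mul, one_mul]
    have h1 : ‖(1 : Matrix n n ℂ) i j‖ ≤ 1 := by
      rw [Matrix.one_apply]
      split_ifs <;> simp
    rw [hinv, Matrix.sub_apply]
    linarith [norm_sub_le ((1 : Matrix n n ℂ) i j) (((p : ℂ) • X⁻¹) i j)]

theorem conjTranspose_mul_inv (h : IsWhitePair p A X) : (A * X⁻¹)ᴴ = X⁻¹ * A := by
  rw [Matrix.conjTranspose_mul, Matrix.conjTranspose_nonsing_inv, h.posSemidef.isHermitian.eq,
    h.posDef.isHermitian.eq]

theorem mul_inv_mul_cancel (h : IsWhitePair p A X) : A * X⁻¹ * X = A :=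
  Matrix.nonsing_inv_mul_cancel_right _ _ h.isUnit_det

/- Completing the square: `g := (A * X⁻¹)ᵀ *ᵥ e` satisfies the normal equations `g X = e A`. -/
theorem quad_sub_two_mul_add_quad (h : IsWhitePair p A X) (e t : n → ℂ) :
    quad A e - 2 * (e ⬝ᵥ (A *ᵥ star t)).re + quad X t =
      quad (A - A * X⁻¹ * A) e + quad X (t - (A * X⁻¹)ᵀ *ᵥ e) := by
  have hX := h.posDef.isHermitian
  set g := (A * X⁻¹)ᵀ *ᵥ e with hg
  rw [Matrix.mulVec_transpose] at hg
  have hnormal (v : n → ℂ) : g ⬝ᵥ (X *ᵥ v) = e ⬝ᵥ (A *ᵥ v) := by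
    rw [hg, ← Matrix.dotProduct_mulVec, Matrix.mulVec_mulVec, h.mul_inv_mul_cancel]
  have hquad : quad X g = quad (A * X⁻¹ * A) e := by
    rw [quad, hnormal, hg, Matrix.star_vecMul, h.conjTranspose_mul_inv, Matrix.mulVec_mulVec, quad,
      mul_assoc]
  rw [quad_sub hX, quad_sub_matrix, re_dotProduct_mulVec_star_comm hX t g, hnormal, hquad]
  ring

theorem sub_mul_inv_mul_posSemidef (h : IsWhitePair p A X) :
    (A - A * X⁻¹ * A).PosSemidef := by
  have hsum : (1 - A * X⁻¹) * A * (1 - A * X⁻¹)ᴴ + A * X⁻¹ * (X - A) * (A * X⁻¹)ᴴ =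
      A - A * X⁻¹ * A := by
    rw [Matrix.conjTranspose_sub, Matrix.conjTranspose_one, h.conjTranspose_mul_inv,
      Matrix.mul_sub (A * X⁻¹), h.mul_inv_mul_cancel]
    noncomm_ring
  exact hsum ▸ (h.posSemidef.mul_mul_conjTranspose_same (1 - A * X⁻¹)).add
    (h.sub_posSemidef.mul_mul_conjTranspose_same (A * X⁻¹))

end IsWhitePair

section Measurability

variable {α n : Type*} [MeasurableSpace α] {ν : Measure α} [Fintype n]

theorem aemeasurable_matrix_inv [DecidableEq n] {M : α → Matrix n n ℂ}
    (hM : ∀ i j, AEMeasurable (M · i j) ν) (i j : n) :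
    AEMeasurable (fun σ => (M σ)⁻¹ i j) ν := by
  have hpi : AEMeasurable (fun σ => fun i j => M σ i j) ν :=
    aemeasurable_pi_iff.2 fun i => aemeasurable_pi_iff.2 fun j => hM i j
  have hof : Continuous fun A : n → n → ℂ => Matrix.of A :=
    continuous_matrix fun i j => (continuous_apply j).comp (continuous_apply i)
  have hinv : Measurable fun A : n → n → ℂ => (Matrix.of A)⁻¹ i j := by
    simp only [Matrix.inv_def, Matrix.smul_apply, Ring.inverse_eq_inv', smul_eq_mul]
    exact hof.matrix_det.measurable.inv.mul (hof.matrix_adjugate.matrix_elem i j).measurable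
  exact hinv.comp_aemeasurable hpi

theorem aemeasurable_matrix_mul {M N : α → Matrix n n ℂ}
    (hM : ∀ i j, AEMeasurable (M · i j) ν) (hN : ∀ i j, AEMeasurable (N · i j) ν) (i j : n) :
    AEMeasurable (fun σ => (M σ * N σ) i j) ν := by
  simp only [Matrix.mul_apply]
  exact Finset.aemeasurable_fun_sum _ fun k _ => (hM i k).mul (hN k j)

theorem aestronglyMeasurable_mulVec {M : α → Matrix n n ℂ} {u : α → n → ℂ}
    (hM : ∀ i j, AEMeasurable (M · i j) ν) (hu : AEStronglyMeasurable u ν) :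
    AEStronglyMeasurable (fun σ => M σ *ᵥ u σ) ν := by
  refine (aemeasurable_pi_iff.2 fun i => ?_).aestronglyMeasurable
  simp only [Matrix.mulVec, dotProduct]
  exact Finset.aemeasurable_fun_sum _ fun j _ =>
    (hM i j).mul (aemeasurable_pi_iff.1 hu.aemeasurable j)

theorem memLp_top_mulVec {M : α → Matrix n n ℂ} {u : α → n → ℂ}
    (hM : ∀ i j, MemLp (M · i j) ∞ ν) (hu : MemLp u ∞ ν) :
    MemLp (fun σ => M σ *ᵥ u σ) ∞ ν :=
  MemLp.of_eval fun i => by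
    simp only [Matrix.mulVec, dotProduct]
    exact memLp_finsetSum _ fun j _ => (hu.eval j).mul (hM i j)

end Measurability

section SquareIntegrable

variable {α : Type*} [MeasurableSpace α] {μ : Measure α}

theorem tendsto_of_le_add_of_le_add {ι : Type*} {l : Filter ι} {a : ℝ≥0∞} {u b : ι → ℝ≥0∞}
    (hle : ∀ k, u k ≤ a + b k) (hge : ∀ k, a ≤ u k + b k) (hb : Tendsto b l (𝓝 0)) :
    Tendsto u l (𝓝 a) := by
  have hadd : Tendsto (fun k => a + b k) l (𝓝 a) := by simpa using tendsto_const_nhds.add hb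
  have hsub : Tendsto (fun k => a - b k) l (𝓝 a) := by
    simpa using ENNReal.Tendsto.sub (tendsto_const_nhds (x := a)) hb (.inr ENNReal.zero_ne_top)
  exact tendsto_of_tendsto_of_tendsto_of_le_of_le hsub hadd
    (fun k => tsub_le_iff_right.2 (hge k)) hle

theorem tendsto_sq_nhds_zero_iff {ι : Type*} {l : Filter ι} {u : ι → ℝ≥0∞} :
    Tendsto (fun k => u k ^ 2) l (𝓝 0) ↔ Tendsto u l (𝓝 0) := by
  refine ⟨fun h => ?_, fun h => by simpa using ENNReal.Tendsto.pow (n := 2) h⟩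
  have hsqrt (a : ℝ≥0∞) : (a ^ 2) ^ (2⁻¹ : ℝ) = a := by
    rw [← ENNReal.rpow_natCast, ← ENNReal.rpow_mul]
    norm_num
  simpa [Function.comp_def, hsqrt] using
    ((ENNReal.continuous_rpow_const (y := (2⁻¹ : ℝ))).tendsto 0).comp h

theorem eLpNorm_two_sq {E : Type*} [NormedAddCommGroup E] (f : α → E) :
    eLpNorm f 2 μ ^ 2 = ∫⁻ x, ‖f x‖ₑ ^ 2 ∂μ := by
  simpa using eLpNorm_nnreal_pow_eq_lintegral (μ := μ) (f := f) (p := 2) two_ne_zero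

theorem eLpNorm_two_sq_eq_ofReal {E : Type*} [NormedAddCommGroup E] {f : α → E}
    (hf : MemLp f 2 μ) : eLpNorm f 2 μ ^ 2 = ENNReal.ofReal (∫ x, ‖f x‖ ^ 2 ∂μ) := by
  rw [eLpNorm_two_sq, ofReal_integral_eq_lintegral_ofReal
    ((memLp_two_iff_integrable_sq_norm hf.1).1 hf) (.of_forall fun _ => by positivity)]
  simp only [ENNReal.ofReal_pow (norm_nonneg _), ofReal_norm]

theorem tendsto_eLpNorm_sub_of_tendsto {E ι : Type*} [NormedAddCommGroup E] {l : Filter ι}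
    {p : ℝ≥0∞} (hp : 1 ≤ p) {f g : α → E} {w : ι → α → E} (hf : AEStronglyMeasurable f μ)
    (hg : AEStronglyMeasurable g μ) (hw : ∀ k, AEStronglyMeasurable (w k) μ)
    (h : Tendsto (fun k => eLpNorm (g - w k) p μ) l (𝓝 0)) :
    Tendsto (fun k => eLpNorm (f - w k) p μ) l (𝓝 (eLpNorm (f - g) p μ)) := by
  refine tendsto_of_le_add_of_le_add (fun k => ?_) (fun k => ?_) h
  · simpa using eLpNorm_add_le (hf.sub hg) (hg.sub (hw k)) hp
  · rw [eLpNorm_sub_comm g]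
    simpa using eLpNorm_add_le (hf.sub (hw k)) ((hw k).sub hg) hp

theorem exists_tendsto_eLpNorm_sub_of_le_add {E : Type*} [NormedAddCommGroup E] [CompleteSpace E]
    {p : ℝ≥0∞} [Fact (1 ≤ p)] {f : ℕ → α → E} (hf : ∀ k, MemLp (f k) p μ) {b : ℕ → ℝ≥0∞}
    (hfb : ∀ k l, eLpNorm (f k - f l) p μ ≤ b k + b l) (hb : Tendsto b atTop (𝓝 0)) :
    ∃ g, MemLp g p μ ∧ Tendsto (fun k => eLpNorm (g - f k) p μ) atTop (𝓝 0) := by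
  have hcauchy : CauchySeq fun k => (hf k).toLp := by
    refine EMetric.cauchySeq_iff.2 fun ε hε => ?_
    obtain ⟨N, hN⟩ := eventually_atTop.1 (hb.eventually (gt_mem_nhds (ENNReal.half_pos hε.ne')))
    refine ⟨N, fun k hk l hl => ?_⟩
    rw [Lp.edist_toLp_toLp, ← ENNReal.add_halves ε]
    exact (hfb k l).trans_lt (ENNReal.add_lt_add (hN k hk) (hN l hl))
  obtain ⟨g, hg⟩ := cauchySeq_tendsto_of_complete hcauchy
  refine ⟨g, Lp.memLp g, ((Lp.tendsto_Lp_iff_tendsto_eLpNorm' _ _).1 hg).congr fun k => ?_⟩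
  rw [eLpNorm_congr_ae ((hf k).coeFn_toLp.sub (.refl _ g)), eLpNorm_sub_comm]

theorem integrable_mul_conj {f g : α → ℂ} (hf : MemLp f 2 μ) (hg : MemLp g 2 μ) :
    Integrable (fun x => f x * conj (g x)) μ :=
  hf.integrable_mul hg.star

theorem integral_norm_sq (f : α → ℂ) :
    ((∫ x, ‖f x‖ ^ 2 ∂μ : ℝ) : ℂ) = ∫ x, f x * conj (f x) ∂μ := by
  simp only [Complex.mul_conj, Complex.normSq_eq_norm_sq]
  exact integral_complex_ofReal.symm

theorem integral_sub_two_mul_add {f g h : α → ℝ} (hf : Integrable f μ) (hg : Integrable g μ)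
    (hh : Integrable h μ) :
    ∫ x, f x ∂μ - 2 * ∫ x, g x ∂μ + ∫ x, h x ∂μ = ∫ x, (f x - 2 * g x + h x) ∂μ := by
  rw [integral_add (f := fun x => f x - 2 * g x) (hf.sub (hg.const_mul 2)) hh,
    integral_sub hf (hg.const_mul 2), integral_const_mul]

theorem integral_norm_sub_sq {f g : α → ℂ} (hf : MemLp f 2 μ) (hg : MemLp g 2 μ) :
    ∫ x, ‖f x - g x‖ ^ 2 ∂μ = (∫ x, f x * conj (f x) ∂μ).re -
      2 * (∫ x, f x * conj (g x) ∂μ).re + (∫ x, g x * conj (g x) ∂μ).re := by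
  have hff := (memLp_two_iff_integrable_sq_norm hf.1).1 hf
  have hgg := (memLp_two_iff_integrable_sq_norm hg.1).1 hg
  have hre : (∫ x, f x * conj (g x) ∂μ).re = ∫ x, (f x * conj (g x)).re ∂μ :=
    (integral_re (integrable_mul_conj hf hg)).symm
  have hfg : Integrable (fun x => (f x * conj (g x)).re) μ := (integrable_mul_conj hf hg).re
  rw [← integral_norm_sq, ← integral_norm_sq, Complex.ofReal_re, Complex.ofReal_re, hre,
    integral_sub_two_mul_add hff hfg hgg]
  refine integral_congr_ae (.of_forall fun x => ?_)
  have := Complex.normSq_sub (f x) (g x)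
  simp only [Complex.normSq_eq_norm_sq] at this
  simp only [this]
  ring

end SquareIntegrable

section KernelNorm

variable {α n : Type*} [MeasurableSpace α] [Fintype n] {ν : Measure α} {K : α → Matrix n n ℂ}
  {u v w : α → n → ℂ}

/-- The seminorm of the space `L²` with matrix weight `K`, which is the completion in the
definition of `HasSpectralIntegral`. -/
def kernelNorm (ν : Measure α) (K : α → Matrix n n ℂ) (u : α → n → ℂ) : ℝ≥0∞ :=
  eLpNorm (fun σ => √(quad (K σ) (u σ))) 2 ν

theorem kernelNorm_sq (ν : Measure α) (K : α → Matrix n n ℂ) (u : α → n → ℂ) :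
    kernelNorm ν K u ^ 2 = ∫⁻ σ, ENNReal.ofReal (quad (K σ) (u σ)) ∂ν := by
  rw [kernelNorm, eLpNorm_two_sq]
  refine lintegral_congr fun σ => ?_
  rw [Real.enorm_of_nonneg (Real.sqrt_nonneg _), ← ENNReal.ofReal_pow (Real.sqrt_nonneg _)]
  rcases le_total 0 (quad (K σ) (u σ)) with hq | hq
  · rw [Real.sq_sqrt hq]
  · simp [Real.sqrt_eq_zero_of_nonpos hq, ENNReal.ofReal_of_nonpos hq]

theorem aestronglyMeasurable_quad (hK : ∀ i j, AEStronglyMeasurable (K · i j) ν)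
    (hu : AEStronglyMeasurable u ν) : AEStronglyMeasurable (fun σ => quad (K σ) (u σ)) ν :=
  Complex.continuous_re.comp_aestronglyMeasurable
    (aestronglyMeasurable_dotProduct_mulVec_star hK hu hu)

theorem integrable_quad (hK : ∀ i j, Integrable (K · i j) ν) (hu : MemLp u ∞ ν) :
    Integrable (fun σ => quad (K σ) (u σ)) ν :=
  (integrable_dotProduct_mulVec_star hK hu hu).re

theorem re_integral_dotProduct_mulVec_star (hK : ∀ i j, Integrable (K · i j) ν)
    (hu : MemLp u ∞ ν) (hv : MemLp v ∞ ν) :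
    (∫ σ, u σ ⬝ᵥ (K σ *ᵥ star (v σ)) ∂ν).re = ∫ σ, (u σ ⬝ᵥ (K σ *ᵥ star (v σ))).re ∂ν :=
  (integral_re (integrable_dotProduct_mulVec_star hK hu hv)).symm

theorem kernelNorm_sq_eq_ofReal (hK : ∀ i j, Integrable (K · i j) ν)
    (hpos : ∀ᵐ σ ∂ν, (K σ).PosSemidef) (hu : MemLp u ∞ ν) :
    kernelNorm ν K u ^ 2 = ENNReal.ofReal (∫ σ, quad (K σ) (u σ) ∂ν) := by
  rw [kernelNorm_sq, ofReal_integral_eq_lintegral_ofReal (integrable_quad hK hu)]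
  filter_upwards [hpos] with σ hσ using quad_nonneg hσ _

theorem kernelNorm_le_eLpNorm (hK : ∀ i j, AEStronglyMeasurable (K · i j) ν)
    (hu : AEStronglyMeasurable u ν) :
    kernelNorm ν K u ≤ eLpNorm u 2 (entryMeasure ν K) := by
  refine (ENNReal.pow_le_pow_left_iff two_ne_zero).1 ?_
  calc kernelNorm ν K u ^ 2 ≤ ∫⁻ σ, ‖u σ ⬝ᵥ (K σ *ᵥ star (u σ))‖ₑ ∂ν := by
        rw [kernelNorm_sq]
        refine lintegral_mono fun σ => ?_
        rw [← ofReal_norm]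
        exact ENNReal.ofReal_le_ofReal (Complex.re_le_norm _)
    _ ≤ eLpNorm u 2 (entryMeasure ν K) ^ 2 := by
        rw [sq]
        exact lintegral_enorm_dotProduct_mulVec_star_le hK hu hu

theorem kernelNorm_add_le (hK : ∀ i j, AEStronglyMeasurable (K · i j) ν)
    (hpos : ∀ᵐ σ ∂ν, (K σ).PosSemidef) (hu : AEStronglyMeasurable u ν)
    (hv : AEStronglyMeasurable v ν) :
    kernelNorm ν K (u + v) ≤ kernelNorm ν K u + kernelNorm ν K v := by
  refine le_trans ?_ (eLpNorm_add_le
    (Real.continuous_sqrt.comp_aestronglyMeasurable (aestronglyMeasurable_quad hK hu))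
    (Real.continuous_sqrt.comp_aestronglyMeasurable (aestronglyMeasurable_quad hK hv)) one_le_two)
  refine eLpNorm_mono_ae ?_
  filter_upwards [hpos] with σ hσ
  simp only [Pi.add_apply]
  rw [Real.norm_of_nonneg (Real.sqrt_nonneg _), Real.norm_of_nonneg (by positivity)]
  exact sqrt_quad_add_le hσ _ _

theorem kernelNorm_sub_comm (ν : Measure α) (K : α → Matrix n n ℂ) (u v : α → n → ℂ) :
    kernelNorm ν K (u - v) = kernelNorm ν K (v - u) := by
  unfold kernelNorm
  congr 1 with σ
  rw [← quad_neg, Pi.sub_apply, neg_sub, Pi.sub_apply]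

theorem kernelNorm_sub_le (hK : ∀ i j, AEStronglyMeasurable (K · i j) ν)
    (hpos : ∀ᵐ σ ∂ν, (K σ).PosSemidef) (hu : AEStronglyMeasurable u ν)
    (hv : AEStronglyMeasurable v ν) (hw : AEStronglyMeasurable w ν) :
    kernelNorm ν K (u - w) ≤ kernelNorm ν K (u - v) + kernelNorm ν K (v - w) := by
  simpa using kernelNorm_add_le hK hpos (hu.sub hv) (hv.sub hw)

theorem tendsto_kernelNorm_sub_of_tendsto {ι : Type*} {l : Filter ι} {w : ι → α → n → ℂ}
    (hK : ∀ i j, AEStronglyMeasurable (K · i j) ν) (hpos : ∀ᵐ σ ∂ν, (K σ).PosSemidef)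
    (hu : AEStronglyMeasurable u ν) (hv : AEStronglyMeasurable v ν)
    (hw : ∀ k, AEStronglyMeasurable (w k) ν)
    (h : Tendsto (fun k => kernelNorm ν K (u - w k)) l (𝓝 0)) :
    Tendsto (fun k => kernelNorm ν K (w k - v)) l (𝓝 (kernelNorm ν K (u - v))) := by
  refine tendsto_of_le_add_of_le_add (fun k => ?_) (fun k => ?_) h
  · rw [kernelNorm_sub_comm ν K u (w k), add_comm]
    exact kernelNorm_sub_le hK hpos (hw k) hu hv
  · rw [add_comm]
    exact kernelNorm_sub_le hK hpos hu (hw k) hv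

end KernelNorm

section SpectralIntegral

variable {Ω : Type*} [MeasurableSpace Ω] {μ : Measure Ω} {P : ℕ} {x y : ℤ → Ω → ℂ}
  {K : ℝ → Matrix (Fin P) (Fin P) ℂ}

theorem memLp_linearCombination {p : ℝ≥0∞} (hx : ∀ n, MemLp (x n) p μ) (c : ℤ →₀ ℂ) :
    MemLp (linearCombination ℂ x c) p μ := by
  rw [linearCombination_apply]
  exact memLp_finsetSum' _ fun n _ => (hx n).const_smul _

theorem hasSpectralIntegral_iff {e : ℤ → ℝ → Fin P → ℂ} {u : ℝ → Fin P → ℂ} {Y : Ω → ℂ} :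
    HasSpectralIntegral μ P x e K u Y ↔ AEStronglyMeasurable u (band P) ∧ MemLp Y 2 μ ∧
      ∃ c : ℕ → ℤ →₀ ℂ,
        Tendsto (fun k => kernelNorm (band P) K (u - linearCombination ℂ e (c k))) atTop (𝓝 0) ∧
        Tendsto (fun k => eLpNorm (Y - linearCombination ℂ x (c k)) 2 μ) atTop (𝓝 0) := by
  have heval (c : ℤ →₀ ℂ) (σ : ℝ) :
      (u - linearCombination ℂ e c) σ = u σ - c.sum fun n a => a • e n σ := by
    simp only [linearCombination_apply, Finsupp.sum, Pi.sub_apply, Finset.sum_apply, Pi.smul_apply]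
  simp only [← tendsto_sq_nhds_zero_iff (u := fun _ => kernelNorm _ _ _), kernelNorm_sq, heval]
  rfl

theorem HasSpectralIntegral.congr {e : ℤ → ℝ → Fin P → ℂ} {u v : ℝ → Fin P → ℂ} {Y : Ω → ℂ}
    (h : HasSpectralIntegral μ P x e K u Y) (huv : u =ᵐ[band P] v) :
    HasSpectralIntegral μ P x e K v Y := by
  obtain ⟨hu, hY, c, hc, hc'⟩ := h
  refine ⟨hu.congr huv, hY, c, hc.congr fun k => lintegral_congr_ae ?_, hc'⟩
  filter_upwards [huv] with σ hσ
  rw [hσ]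

theorem integral_linearCombination_mul_conj (hx : ∀ n, MemLp (x n) 2 μ) {g : Ω → ℂ}
    (hg : MemLp g 2 μ) (hK : ∀ i j, Integrable (K · i j) (band P)) {v : ℝ → Fin P → ℂ}
    (hv : MemLp v ∞ (band P))
    (hm : ∀ n, ∫ ω, x n ω * conj (g ω) ∂μ = ∫ σ, clBasis P n σ ⬝ᵥ (K σ *ᵥ star (v σ)) ∂(band P))
    (c : ℤ →₀ ℂ) :
    ∫ ω, linearCombination ℂ x c ω * conj (g ω) ∂μ =
      ∫ σ, linearCombination ℂ (clBasis P) c σ ⬝ᵥ (K σ *ᵥ star (v σ)) ∂(band P) := by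
  induction c using Finsupp.induction_linear with
  | zero => simp
  | add c c' hc hc' =>
    simp only [map_add, Pi.add_apply, add_mul, add_dotProduct]
    rw [integral_add (integrable_mul_conj (memLp_linearCombination hx c) hg)
      (integrable_mul_conj (memLp_linearCombination hx c') hg), hc, hc', ← integral_add]
    all_goals exact integrable_dotProduct_mulVec_star hK (memLp_linearCombination_clBasis ∞ _) hv
  | single n a =>
    simp only [Finsupp.linearCombination_single, Pi.smul_apply, smul_eq_mul, mul_assoc,
      smul_dotProduct, integral_const_mul, hm]

theorem integral_mul_conj_linearCombination {f : Ω → ℂ} (hf : MemLp f 2 μ)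
    (hy : ∀ n, MemLp (y n) 2 μ) (hK : ∀ i j, Integrable (K · i j) (band P))
    {u : ℝ → Fin P → ℂ} (hu : MemLp u ∞ (band P))
    (hm : ∀ n, ∫ ω, f ω * conj (y n ω) ∂μ = ∫ σ, u σ ⬝ᵥ (K σ *ᵥ star (clBasis P n σ)) ∂(band P))
    (c : ℤ →₀ ℂ) :
    ∫ ω, f ω * conj (linearCombination ℂ y c ω) ∂μ =
      ∫ σ, u σ ⬝ᵥ (K σ *ᵥ star (linearCombination ℂ (clBasis P) c σ)) ∂(band P) := by
  induction c using Finsupp.induction_linear with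
  | zero => simp
  | add c c' hc hc' =>
    simp only [map_add, Pi.add_apply, mul_add, star_add, Matrix.mulVec_add, dotProduct_add]
    rw [integral_add (integrable_mul_conj hf (memLp_linearCombination hy c))
      (integrable_mul_conj hf (memLp_linearCombination hy c')), hc, hc', ← integral_add]
    all_goals exact integrable_dotProduct_mulVec_star hK hu (memLp_linearCombination_clBasis ∞ _)
  | single n a =>
    simp only [Finsupp.linearCombination_single, Pi.smul_apply, smul_eq_mul, map_mul,
      mul_left_comm (_ : ℂ) (conj a), star_smul, Matrix.mulVec_smul, dotProduct_smul,
      integral_const_mul, hm, RCLike.star_def]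

end SpectralIntegral

/-- `K` is the spectral matrix of the second-order process `x`: the map `clBasis P n ↦ x n` is an
isometry for the weight `K`. -/
structure HasSpectralMatrix {Ω : Type*} [MeasurableSpace Ω] (μ : Measure Ω) (P : ℕ)
    (x : ℤ → Ω → ℂ) (K : ℝ → Matrix (Fin P) (Fin P) ℂ) : Prop where
  memLp : ∀ n, MemLp (x n) 2 μ
  integrable : ∀ i j, Integrable (K · i j) (band P)
  moment : ∀ n m, ∫ ω, x n ω * conj (x m ω) ∂μ =
    ∫ σ, clBasis P n σ ⬝ᵥ (K σ *ᵥ star (clBasis P m σ)) ∂(band P)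

namespace HasSpectralMatrix

variable {Ω : Type*} [MeasurableSpace Ω] {μ : Measure Ω} {P : ℕ} {x : ℤ → Ω → ℂ}
  {K : ℝ → Matrix (Fin P) (Fin P) ℂ} {u v : ℝ → Fin P → ℂ} {Y Z : Ω → ℂ}

theorem aestronglyMeasurable (h : HasSpectralMatrix μ P x K) (i j : Fin P) :
    AEStronglyMeasurable (K · i j) (band P) :=
  (h.integrable i j).1

theorem integral_linearCombination (h : HasSpectralMatrix μ P x K) (c c' : ℤ →₀ ℂ) :
    ∫ ω, linearCombination ℂ x c ω * conj (linearCombination ℂ x c' ω) ∂μ =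
      ∫ σ, linearCombination ℂ (clBasis P) c σ ⬝ᵥ
        (K σ *ᵥ star (linearCombination ℂ (clBasis P) c' σ)) ∂(band P) :=
  integral_linearCombination_mul_conj h.memLp (memLp_linearCombination h.memLp c') h.integrable
    (memLp_linearCombination_clBasis ∞ c') (fun n => integral_mul_conj_linearCombination (h.memLp n)
      h.memLp h.integrable (memLp_clBasis ∞ n) (h.moment n) c') c

theorem integral_norm_linearCombination_sq (h : HasSpectralMatrix μ P x K) (c : ℤ →₀ ℂ) :
    ((∫ ω, ‖linearCombination ℂ x c ω‖ ^ 2 ∂μ : ℝ) : ℂ) =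
      ∫ σ, linearCombination ℂ (clBasis P) c σ ⬝ᵥ
        (K σ *ᵥ star (linearCombination ℂ (clBasis P) c σ)) ∂(band P) := by
  rw [integral_norm_sq, h.integral_linearCombination]

theorem ae_posSemidef [NeZero P] (h : HasSpectralMatrix μ P x K) :
    ∀ᵐ σ ∂(band P), (K σ).PosSemidef :=
  ae_posSemidef_of_integral_nonneg h.integrable fun c => by
    rw [← h.integral_norm_linearCombination_sq]
    exact_mod_cast integral_nonneg fun ω => sq_nonneg _

variable [NeZero P]

theorem eLpNorm_linearCombination (h : HasSpectralMatrix μ P x K) (c : ℤ →₀ ℂ) :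
    eLpNorm (linearCombination ℂ x c) 2 μ =
      kernelNorm (band P) K (linearCombination ℂ (clBasis P) c) := by
  have hc := memLp_linearCombination_clBasis (P := P) ∞ c
  rw [← (ENNReal.pow_right_strictMono two_ne_zero).injective.eq_iff (a := eLpNorm _ _ _),
    eLpNorm_two_sq_eq_ofReal (memLp_linearCombination h.memLp c),
    kernelNorm_sq_eq_ofReal h.integrable h.ae_posSemidef hc]
  simp only [quad]
  rw [← re_integral_dotProduct_mulVec_star h.integrable hc hc,
    ← h.integral_norm_linearCombination_sq, Complex.ofReal_re]

theorem eLpNorm_linearCombination_sub_le (h : HasSpectralMatrix μ P x K)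
    (hu : AEStronglyMeasurable u (band P)) (c c' : ℤ →₀ ℂ) :
    eLpNorm (linearCombination ℂ x c - linearCombination ℂ x c') 2 μ ≤
      kernelNorm (band P) K (u - linearCombination ℂ (clBasis P) c) +
        kernelNorm (band P) K (u - linearCombination ℂ (clBasis P) c') := by
  rw [← map_sub, h.eLpNorm_linearCombination, map_sub, kernelNorm_sub_comm _ _ u]
  exact kernelNorm_sub_le h.aestronglyMeasurable h.ae_posSemidef
    (memLp_linearCombination_clBasis ∞ c).1 hu (memLp_linearCombination_clBasis ∞ c').1

theorem ae_eq_of_hasCLIntegral (h : HasSpectralMatrix μ P x K) (hY : HasCLIntegral μ P x K u Y)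
    (hZ : HasCLIntegral μ P x K u Z) : Y =ᵐ[μ] Z := by
  obtain ⟨hu, hY, c, hc, hYc⟩ := hasSpectralIntegral_iff.1 hY
  obtain ⟨-, hZ, c', hc', hZc'⟩ := hasSpectralIntegral_iff.1 hZ
  have hx (c : ℤ →₀ ℂ) := (memLp_linearCombination h.memLp c).1
  have hle (k : ℕ) : eLpNorm (Y - Z) 2 μ ≤ eLpNorm (Y - linearCombination ℂ x (c k)) 2 μ +
      (kernelNorm (band P) K (u - linearCombination ℂ (clBasis P) (c k)) +
        kernelNorm (band P) K (u - linearCombination ℂ (clBasis P) (c' k)) +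
      eLpNorm (Z - linearCombination ℂ x (c' k)) 2 μ) :=
    calc eLpNorm (Y - Z) 2 μ
        ≤ eLpNorm (Y - linearCombination ℂ x (c k)) 2 μ +
            eLpNorm (linearCombination ℂ x (c k) - Z) 2 μ := by
          simpa using eLpNorm_add_le (hY.1.sub (hx (c k))) ((hx (c k)).sub hZ.1) one_le_two
      _ ≤ _ := by
          gcongr
          refine le_trans ?_ (add_le_add_left (h.eLpNorm_linearCombination_sub_le hu _ _) _)
          rw [eLpNorm_sub_comm Z]
          simpa using eLpNorm_add_le ((hx (c k)).sub (hx (c' k))) ((hx (c' k)).sub hZ.1) one_le_two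
  have hzero : eLpNorm (Y - Z) 2 μ = 0 :=
    nonpos_iff_eq_zero.1 (by simpa using ge_of_tendsto' (hYc.add ((hc.add hc').add hZc')) hle)
  exact (sub_ae_eq_zero Y Z).1 ((eLpNorm_eq_zero_iff (hY.1.sub hZ.1) two_ne_zero).1 hzero)

theorem exists_hasCLIntegral (h : HasSpectralMatrix μ P x K) (hu : MemLp u ∞ (band P)) :
    ∃ Y, HasCLIntegral μ P x K u Y := by
  obtain ⟨c, hc⟩ := exists_tendsto_eLpNorm_sub_clBasis h.integrable
    (memLp_entryMeasure h.integrable hu 2)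
  have hkernel : Tendsto
      (fun k => kernelNorm (band P) K (u - linearCombination ℂ (clBasis P) (c k))) atTop (𝓝 0) :=
    tendsto_of_tendsto_of_tendsto_of_le_of_le tendsto_const_nhds hc (fun _ => zero_le) fun k =>
      kernelNorm_le_eLpNorm h.aestronglyMeasurable
        (hu.1.sub (memLp_linearCombination_clBasis ∞ (c k)).1)
  have : Fact ((1 : ℝ≥0∞) ≤ 2) := ⟨one_le_two⟩
  obtain ⟨Y, hY, hYc⟩ := exists_tendsto_eLpNorm_sub_of_le_add
    (fun k => memLp_linearCombination h.memLp (c k))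
    (fun k l => h.eLpNorm_linearCombination_sub_le hu.1 (c k) (c l)) hkernel
  exact ⟨Y, hasSpectralIntegral_iff.2 ⟨hu.1, hY, c, hkernel, hYc⟩⟩

end HasSpectralMatrix

/-- The data of the filtering problem: a signal `d` and an observation `x` with spectral matrices
`D` and `X`. Signal and noise are uncorrelated, so that `D` is also the cross-spectral matrix of
`d` and `x`; one of them is white of power `p`. -/
structure IsSpectralModel {Ω : Type*} [MeasurableSpace Ω] (μ : Measure Ω) (P : ℕ) (p : ℝ)
    (d x : ℤ → Ω → ℂ) (D X : ℝ → Matrix (Fin P) (Fin P) ℂ) : Prop where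
  signal : HasSpectralMatrix μ P d D
  obs : HasSpectralMatrix μ P x X
  moment_cross : ∀ n m, ∫ ω, d n ω * conj (x m ω) ∂μ =
    ∫ σ, clBasis P n σ ⬝ᵥ (D σ *ᵥ star (clBasis P m σ)) ∂(band P)
  white : ∀ᵐ σ ∂(band P), IsWhitePair p (D σ) (X σ)

/-- The matrix of the Wiener filter for signal spectrum `D` and observation spectrum `X`. It acts
on the coefficient vector `h` of a spectral integral, hence the transpose. -/
def wienerMat {n : Type*} [Fintype n] [DecidableEq n] (D X : ℝ → Matrix n n ℂ) (σ : ℝ) :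
    Matrix n n ℂ :=
  (D σ * (X σ)⁻¹)ᵀ

/-- The spectral matrix of the error of the Wiener filter. -/
def errMat {n : Type*} [Fintype n] [DecidableEq n] (D X : ℝ → Matrix n n ℂ) (σ : ℝ) :
    Matrix n n ℂ :=
  D σ - D σ * (X σ)⁻¹ * D σ

/-- The mean square error of the Wiener filter at time `n`. -/
def minErr {P : ℕ} (D X : ℝ → Matrix (Fin P) (Fin P) ℂ) (n : ℤ) : ℝ :=
  ∫ σ, quad (errMat D X σ) (clBasis P n σ) ∂(band P)

namespace IsSpectralModel

variable {Ω : Type*} [MeasurableSpace Ω] {μ : Measure Ω} {P : ℕ} {p : ℝ}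
  {d x : ℤ → Ω → ℂ} {D X : ℝ → Matrix (Fin P) (Fin P) ℂ}

theorem memLp_wienerMat (h : IsSpectralModel μ P p d x D X) (i j : Fin P) :
    MemLp (wienerMat D X · i j) ∞ (band P) := by
  have hmeas : AEMeasurable (wienerMat D X · i j) (band P) :=
    aemeasurable_matrix_mul (fun i j => (h.signal.integrable i j).1.aemeasurable)
      (aemeasurable_matrix_inv fun i j => (h.obs.integrable i j).1.aemeasurable) j i
  refine memLp_top_of_bound hmeas.aestronglyMeasurable 2 ?_
  filter_upwards [h.white] with σ hσ using hσ.norm_mul_inv_apply_le j i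

theorem memLp_wienerMat_mulVec_clBasis (h : IsSpectralModel μ P p d x D X) (n : ℤ) :
    MemLp (fun σ => wienerMat D X σ *ᵥ clBasis P n σ) ∞ (band P) :=
  memLp_top_mulVec h.memLp_wienerMat (memLp_clBasis ∞ n)

theorem integrable_errMat (h : IsSpectralModel μ P p d x D X) (i j : Fin P) :
    Integrable (errMat D X · i j) (band P) := by
  simp only [errMat, Matrix.sub_apply, Matrix.mul_apply (M := D _ * (X _)⁻¹)]
  exact (h.signal.integrable i j).sub (integrable_finsetSum _ fun k _ =>
    (h.signal.integrable k j).mul_of_top_right (h.memLp_wienerMat k i))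

theorem integrable_trace_errMat (h : IsSpectralModel μ P p d x D X) :
    Integrable (fun σ => (errMat D X σ).trace) (band P) :=
  integrable_finsetSum _ fun i _ => h.integrable_errMat i i

theorem integrable_quad_errMat (h : IsSpectralModel μ P p d x D X) (n : ℤ) :
    Integrable (fun σ => quad (errMat D X σ) (clBasis P n σ)) (band P) :=
  integrable_quad h.integrable_errMat (memLp_clBasis ∞ n)

theorem minErr_nonneg (h : IsSpectralModel μ P p d x D X) (n : ℤ) : 0 ≤ minErr D X n := by
  refine integral_nonneg_of_ae ?_
  filter_upwards [h.white] with σ hσ using quad_nonneg hσ.sub_mul_inv_mul_posSemidef _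

theorem ae_posSemidef_obs (h : IsSpectralModel μ P p d x D X) :
    ∀ᵐ σ ∂(band P), (X σ).PosSemidef := by
  filter_upwards [h.white] with σ hσ using hσ.posDef.posSemidef

theorem integral_norm_sub_linearCombination_sq (h : IsSpectralModel μ P p d x D X) (n : ℤ)
    (c : ℤ →₀ ℂ) :
    ∫ ω, ‖d n ω - linearCombination ℂ x c ω‖ ^ 2 ∂μ = minErr D X n + ∫ σ, quad (X σ)
      (linearCombination ℂ (clBasis P) c σ - wienerMat D X σ *ᵥ clBasis P n σ) ∂(band P) := by
  have he := memLp_clBasis (P := P) ∞ n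
  have ht := memLp_linearCombination_clBasis (P := P) ∞ c
  have hDet := integrable_dotProduct_mulVec_star h.signal.integrable he ht
  have hq : Integrable (fun σ => quad (X σ)
      (linearCombination ℂ (clBasis P) c σ - wienerMat D X σ *ᵥ clBasis P n σ)) (band P) :=
    integrable_quad h.obs.integrable (ht.sub (h.memLp_wienerMat_mulVec_clBasis n))
  rw [integral_norm_sub_sq (h.signal.memLp n) (memLp_linearCombination h.obs.memLp c),
    h.signal.moment, h.obs.integral_linearCombination, integral_mul_conj_linearCombination
      (h.signal.memLp n) h.obs.memLp h.signal.integrable he (h.moment_cross n),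
    re_integral_dotProduct_mulVec_star h.signal.integrable he he,
    re_integral_dotProduct_mulVec_star h.signal.integrable he ht,
    re_integral_dotProduct_mulVec_star h.obs.integrable ht ht]
  calc _ = ∫ σ, (quad (D σ) (clBasis P n σ) -
          2 * (clBasis P n σ ⬝ᵥ (D σ *ᵥ star (linearCombination ℂ (clBasis P) c σ))).re +
          quad (X σ) (linearCombination ℂ (clBasis P) c σ)) ∂(band P) :=
        integral_sub_two_mul_add (integrable_quad h.signal.integrable he) hDet.re
          (integrable_quad h.obs.integrable ht)
    _ = ∫ σ, (quad (errMat D X σ) (clBasis P n σ) + quad (X σ)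
          (linearCombination ℂ (clBasis P) c σ - wienerMat D X σ *ᵥ clBasis P n σ)) ∂(band P) := by
        refine integral_congr_ae ?_
        filter_upwards [h.white] with σ hσ using hσ.quad_sub_two_mul_add_quad _ _
    _ = _ := integral_add (h.integrable_quad_errMat n) hq

theorem eLpNorm_sub_linearCombination_sq (h : IsSpectralModel μ P p d x D X) (n : ℤ)
    (c : ℤ →₀ ℂ) :
    eLpNorm (d n - linearCombination ℂ x c) 2 μ ^ 2 = ENNReal.ofReal (minErr D X n) +
      kernelNorm (band P) X (linearCombination ℂ (clBasis P) c -
        fun σ => wienerMat D X σ *ᵥ clBasis P n σ) ^ 2 := by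
  have hf : MemLp (d n - linearCombination ℂ x c) 2 μ :=
    (h.signal.memLp n).sub (memLp_linearCombination h.obs.memLp c)
  have ht := (memLp_linearCombination_clBasis (P := P) ∞ c).sub
    (h.memLp_wienerMat_mulVec_clBasis n)
  rw [eLpNorm_two_sq_eq_ofReal hf, kernelNorm_sq_eq_ofReal h.obs.integrable h.ae_posSemidef_obs ht,
    ← ENNReal.ofReal_add (h.minErr_nonneg n)]
  · exact congrArg ENNReal.ofReal (h.integral_norm_sub_linearCombination_sq n c)
  · refine integral_nonneg_of_ae ?_
    filter_upwards [h.ae_posSemidef_obs] with σ hσ using quad_nonneg hσ _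

theorem eLpNorm_sub_sq (h : IsSpectralModel μ P p d x D X) (n : ℤ) {u : ℝ → Fin P → ℂ}
    {Y : Ω → ℂ} (hY : HasCLIntegral μ P x X u Y) :
    eLpNorm (d n - Y) 2 μ ^ 2 = ENNReal.ofReal (minErr D X n) +
      kernelNorm (band P) X (u - fun σ => wienerMat D X σ *ᵥ clBasis P n σ) ^ 2 := by
  obtain ⟨hu, hY, c, hc, hYc⟩ := hasSpectralIntegral_iff.1 hY
  have herr : Tendsto (fun k => eLpNorm (d n - linearCombination ℂ x (c k)) 2 μ ^ 2) atTop
      (𝓝 (eLpNorm (d n - Y) 2 μ ^ 2)) :=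
    ENNReal.Tendsto.pow (tendsto_eLpNorm_sub_of_tendsto one_le_two (h.signal.memLp n).1 hY.1
      (fun k => (memLp_linearCombination h.obs.memLp (c k)).1) hYc)
  simp only [h.eLpNorm_sub_linearCombination_sq] at herr
  exact tendsto_nhds_unique herr (tendsto_const_nhds.add (ENNReal.Tendsto.pow
    (tendsto_kernelNorm_sub_of_tendsto h.obs.aestronglyMeasurable h.ae_posSemidef_obs hu
      (h.memLp_wienerMat_mulVec_clBasis n).1 (fun k => (memLp_linearCombination_clBasis ∞ (c k)).1)
      hc)))

end IsSpectralModel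

section PeriodicAverages

variable {P : ℕ}

theorem sum_Icc_int_eq_sum_range {M : Type*} [AddCommMonoid M] (f : ℤ → M) (m : ℤ) (N : ℕ) :
    ∑ n ∈ Finset.Icc m (m + N - 1), f n = ∑ i ∈ Finset.range N, f (i + m) := by
  rw [Int.Icc_eq_finset_map, Finset.sum_map, sub_add_cancel, add_sub_cancel_left, Int.toNat_natCast]
  simp [add_comm]

theorem norm_sum_range_add_le_of_periodic [NeZero P] {E : Type*} [SeminormedAddCommGroup E]
    {b : ℤ → E} (hb : Function.Periodic b P) (h0 : ∑ i ∈ Finset.range P, b i = 0) (m : ℤ) (N : ℕ) :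
    ‖∑ i ∈ Finset.range N, b (i + m)‖ ≤ ∑ i ∈ Finset.range P, ‖b i‖ := by
  have hper : Function.Periodic (fun N => ∑ i ∈ Finset.range N, b (i + m)) P := fun N => by
    have hwindow : ∑ i ∈ Finset.range P, b ((N + i : ℕ) + m) = 0 := by
      rw [← h0, ← sum_range_add_of_periodic hb (N + m)]
      push_cast
      simp only [add_left_comm, add_assoc]
    simp only [Finset.sum_range_add, hwindow, add_zero]
  calc ‖∑ i ∈ Finset.range N, b (i + m)‖
      = ‖∑ i ∈ Finset.range (N % P), b (i + m)‖ := congrArg norm (hper.map_mod_nat N).symm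
    _ ≤ ∑ i ∈ Finset.range (N % P), ‖b (i + m)‖ := norm_sum_le _ _
    _ ≤ ∑ i ∈ Finset.range P, ‖b (i + m)‖ := Finset.sum_le_sum_of_subset_of_nonneg
        (Finset.range_subset_range.2 (Nat.mod_lt _ (NeZero.pos P)).le) fun _ _ _ => norm_nonneg _
    _ = ∑ i ∈ Finset.range P, ‖b i‖ :=
        sum_range_add_of_periodic (g := fun i => ‖b i‖) (fun i => congrArg norm (hb i)) m

theorem tendsto_average_of_periodic [NeZero P] {a : ℤ → ℝ} (ha : Function.Periodic a P) :
    Tendsto (fun K : ℕ => 1 / ((((K : ℤ) - 1 : ℤ) : ℝ) - ((-(K : ℤ) : ℤ) : ℝ)) *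
      ∑ n ∈ Finset.Icc (-(K : ℤ)) ((K : ℤ) - 1), a n) atTop
      (𝓝 (1 / P * ∑ n ∈ Finset.range P, a n)) := by
  have hP : (P : ℝ) ≠ 0 := NeZero.ne _
  set A := 1 / (P : ℝ) * ∑ n ∈ Finset.range P, a n with hA
  have hb : Function.Periodic (fun n => a n - A) P := fun n => congrArg (· - A) (ha n)
  have h0 : ∑ n ∈ Finset.range P, (a n - A) = 0 := by
    rw [Finset.sum_sub_distrib, Finset.sum_const, Finset.card_range, hA, nsmul_eq_mul,
      one_div, mul_inv_cancel_left₀ hP, sub_self]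
  let dev (K : ℕ) : ℝ := ∑ i ∈ Finset.range (2 * K), (a (i + -(K : ℤ)) - A) + A
  have hsum (K : ℕ) :
      ∑ n ∈ Finset.Icc (-(K : ℤ)) ((K : ℤ) - 1), a n = dev K + (2 * K - 1) * A := by
    have h := sum_Icc_int_eq_sum_range a (-(K : ℤ)) (2 * K)
    rw [show -(K : ℤ) + (2 * K : ℕ) - 1 = K - 1 by push_cast; ring] at h
    simp only [dev, h, Finset.sum_sub_distrib, Finset.sum_const, Finset.card_range, nsmul_eq_mul]
    push_cast
    ring
  have hbdd : IsBoundedUnder (· ≤ ·) atTop (norm ∘ dev) :=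
    isBoundedUnder_of ⟨∑ i ∈ Finset.range P, ‖a i - A‖ + ‖A‖, fun K => (norm_add_le _ _).trans
      (add_le_add_left (norm_sum_range_add_le_of_periodic hb h0 _ _) _)⟩
  have hinv : Tendsto (fun K : ℕ => (2 * (K : ℝ) - 1)⁻¹) atTop (𝓝 0) :=
    tendsto_inv_atTop_zero.comp (tendsto_atTop_add_const_right _ _
      (tendsto_natCast_atTop_atTop.const_mul_atTop two_pos))
  have hlim := (hinv.zero_mul_isBoundedUnder_le hbdd).add_const A
  rw [zero_add] at hlim
  refine hlim.congr' ?_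
  filter_upwards [eventually_ge_atTop 1] with K hK
  have hne : 2 * (K : ℝ) - 1 ≠ 0 := by
    have : (1 : ℝ) ≤ K := by exact_mod_cast hK
    linarith
  rw [hsum, mul_add _ (dev K), show (((K : ℤ) - 1 : ℤ) : ℝ) - ((-(K : ℤ) : ℤ) : ℝ) = 2 * K - 1 by
    push_cast; ring, one_div, inv_mul_cancel_left₀ hne]

end PeriodicAverages

section CramerLoeveBasisSums

variable {P : ℕ} [NeZero P]

theorem eq_of_mulVec_clBasis_eq {M N : Matrix (Fin P) (Fin P) ℂ} {σ : ℝ}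
    (h : ∀ n ∈ Finset.range P, M *ᵥ clBasis P n σ = N *ᵥ clBasis P n σ) : M = N :=
  Matrix.ext_of_mulVec_single fun i => by
    rw [← sum_dotProduct_smul_clBasis (Pi.single i 1) σ]
    simp only [Matrix.mulVec_sum, Matrix.mulVec_smul]
    exact Finset.sum_congr rfl fun n hn => by rw [h n hn]

theorem sum_quad_clBasis (K : Matrix (Fin P) (Fin P) ℂ) (σ : ℝ) :
    ∑ n ∈ Finset.range P, quad K (clBasis P n σ) = P * K.trace.re := by
  have hentry (i j : Fin P) :
      ∑ n ∈ Finset.range P, clBasis P n σ i * (K i j * star (clBasis P n σ j)) =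
        if i = j then P * K i j else 0 := by
    simp only [mul_left_comm (clBasis P _ σ i), ← Finset.mul_sum, RCLike.star_def,
      sum_clBasis_mul_conj_clBasis, mul_ite, mul_zero, mul_comm (P : ℂ)]
  have htrace : ∑ n ∈ Finset.range P, clBasis P n σ ⬝ᵥ (K *ᵥ star (clBasis P n σ)) =
      P * K.trace := by
    simp only [dotProduct, Matrix.mulVec, Finset.mul_sum, Pi.star_apply]
    rw [Finset.sum_comm]
    simp only [Finset.sum_comm (s := Finset.range P), hentry, Finset.sum_ite_eq, Finset.mem_univ,
      if_true, Matrix.trace, Matrix.diag_apply, Finset.mul_sum]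
  simp only [quad, ← Complex.re_sum, htrace]
  exact_mod_cast Complex.re_ofReal_mul P K.trace

theorem periodic_quad_mulVec_clBasis (K M : Matrix (Fin P) (Fin P) ℂ) (σ : ℝ) :
    Function.Periodic (fun n => quad K (M *ᵥ clBasis P n σ)) P := fun n => by
  have h := clBasis_mul_add (P := P) 1 n σ
  rw [one_mul, add_comm] at h
  simp only [h, Matrix.mulVec_smul, quad_smul, norm_cexp2pi, one_pow, one_mul]

theorem periodic_minErr (D X : ℝ → Matrix (Fin P) (Fin P) ℂ) :
    Function.Periodic (minErr D X) P := fun n => by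
  have h (σ : ℝ) := periodic_quad_mulVec_clBasis (errMat D X σ) 1 σ n
  simp only [Matrix.one_mulVec] at h
  simp only [minErr, h]

end CramerLoeveBasisSums

/-- The process `dhat` is the output, for input `x`, of the filter with the matrix response `M` in
the Cramér–Loève domain; FRESH filters and scalar filters in the KL domain both have this form. -/
def IsMatOutput {Ω : Type*} [MeasurableSpace Ω] (μ : Measure Ω) (P : ℕ) (x : ℤ → Ω → ℂ)
    (X M : ℝ → Matrix (Fin P) (Fin P) ℂ) (dhat : ℤ → Ω → ℂ) : Prop :=
  ∀ n, HasCLIntegral μ P x X (fun σ => M σ *ᵥ clBasis P n σ) (dhat n)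

/-- The error power of the Wiener filter. -/
def minPower {P : ℕ} (D X : ℝ → Matrix (Fin P) (Fin P) ℂ) : ℝ :=
  1 / P * ∑ n ∈ Finset.range P, minErr D X n

/-- By how much the error at time `n` of the filter with the matrix response `M` exceeds that of
the Wiener filter. -/
def excess {P : ℕ} (D X M : ℝ → Matrix (Fin P) (Fin P) ℂ) (n : ℤ) : ℝ≥0∞ :=
  kernelNorm (band P) X (fun σ => (M σ - wienerMat D X σ) *ᵥ clBasis P n σ) ^ 2

section MatrixFilters

variable {Ω : Type*} [MeasurableSpace Ω] {μ : Measure Ω} {P : ℕ} {x dhat : ℤ → Ω → ℂ}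
  {D X M M' : ℝ → Matrix (Fin P) (Fin P) ℂ}

theorem IsMatOutput.congr (h : IsMatOutput μ P x X M dhat) (hM : M =ᵐ[band P] M') :
    IsMatOutput μ P x X M' dhat := fun n =>
  HasSpectralIntegral.congr (h n) (by filter_upwards [hM] with σ hσ; rw [hσ])

theorem isMatOutput_congr_ae (hM : M =ᵐ[band P] M') :
    IsMatOutput μ P x X M dhat ↔ IsMatOutput μ P x X M' dhat :=
  ⟨fun h => h.congr hM, fun h => h.congr hM.symm⟩

theorem periodic_excess [NeZero P] (D X M : ℝ → Matrix (Fin P) (Fin P) ℂ) :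
    Function.Periodic (excess D X M) P := fun n => by
  simp only [excess, kernelNorm, fun σ =>
    periodic_quad_mulVec_clBasis (X σ) (M σ - wienerMat D X σ) σ n]

theorem excess_wienerMat (D X : ℝ → Matrix (Fin P) (Fin P) ℂ) (n : ℤ) :
    excess D X (wienerMat D X) n = 0 := by
  simp [excess, kernelNorm, quad]

end MatrixFilters

namespace IsSpectralModel

variable {Ω : Type*} [MeasurableSpace Ω] {μ : Measure Ω} {P : ℕ} {p : ℝ}
  {d x dhat : ℤ → Ω → ℂ} {D X M : ℝ → Matrix (Fin P) (Fin P) ℂ}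

theorem eLpNorm_sub_sq_eq_minErr_add_excess (h : IsSpectralModel μ P p d x D X)
    (hM : IsMatOutput μ P x X M dhat) (n : ℤ) :
    eLpNorm (d n - dhat n) 2 μ ^ 2 = ENNReal.ofReal (minErr D X n) + excess D X M n := by
  simp only [h.eLpNorm_sub_sq n (hM n), excess, Matrix.sub_mulVec]
  rfl

theorem excess_ne_top (h : IsSpectralModel μ P p d x D X) (hM : IsMatOutput μ P x X M dhat)
    (n : ℤ) : excess D X M n ≠ ∞ := by
  have hfin := ENNReal.pow_ne_top (n := 2) ((h.signal.memLp n).sub (hM n).2.1).2.ne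
  rw [h.eLpNorm_sub_sq_eq_minErr_add_excess hM] at hfin
  exact (ENNReal.add_ne_top.1 hfin).2

theorem integral_norm_sub_sq_eq (h : IsSpectralModel μ P p d x D X)
    (hM : IsMatOutput μ P x X M dhat) (n : ℤ) :
    ∫ ω, ‖d n ω - dhat n ω‖ ^ 2 ∂μ = minErr D X n + (excess D X M n).toReal := by
  have herr := h.eLpNorm_sub_sq_eq_minErr_add_excess hM n
  rw [eLpNorm_two_sq_eq_ofReal ((h.signal.memLp n).sub (hM n).2.1)] at herr
  rw [← ENNReal.toReal_ofReal (h.minErr_nonneg n),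
    ← ENNReal.toReal_add ENNReal.ofReal_ne_top (h.excess_ne_top hM n), ← herr]
  exact (ENNReal.toReal_ofReal (integral_nonneg fun _ => sq_nonneg _)).symm

theorem integral_norm_sub_sq_le (h : IsSpectralModel μ P p d x D X)
    (hM : IsMatOutput μ P x X (wienerMat D X) dhat) (n : ℤ) (c : ℤ →₀ ℂ) :
    ∫ ω, ‖d n ω - dhat n ω‖ ^ 2 ∂μ ≤ ∫ ω, ‖d n ω - linearCombination ℂ x c ω‖ ^ 2 ∂μ := by
  rw [h.integral_norm_sub_sq_eq hM, excess_wienerMat, ENNReal.toReal_zero,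
    h.integral_norm_sub_linearCombination_sq]
  refine (add_le_add_iff_left _).2 (integral_nonneg_of_ae ?_)
  filter_upwards [h.ae_posSemidef_obs] with σ hσ using quad_nonneg hσ _

theorem ae_mulVec_clBasis_eq_of_excess_eq_zero (h : IsSpectralModel μ P p d x D X)
    (hM : IsMatOutput μ P x X M dhat) {n : ℤ} (h0 : excess D X M n = 0) :
    ∀ᵐ σ ∂(band P), M σ *ᵥ clBasis P n σ = wienerMat D X σ *ᵥ clBasis P n σ := by
  have hmeas : AEStronglyMeasurable (fun σ => (M σ - wienerMat D X σ) *ᵥ clBasis P n σ)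
      (band P) := by
    simp only [Matrix.sub_mulVec]
    exact (hM n).1.sub (h.memLp_wienerMat_mulVec_clBasis n).1
  have hsqrt := (eLpNorm_eq_zero_iff (Real.continuous_sqrt.comp_aestronglyMeasurable
    (aestronglyMeasurable_quad h.obs.aestronglyMeasurable hmeas)) two_ne_zero).1
    (eq_zero_of_pow_eq_zero h0)
  filter_upwards [hsqrt, h.white] with σ hσ hwhite
  have hquad := (Real.sqrt_eq_zero (quad_nonneg hwhite.posDef.posSemidef _)).1 hσ
  have hzero := eq_zero_of_quad_eq_zero hwhite.posDef hquad
  rwa [Matrix.sub_mulVec, sub_eq_zero] at hzero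

variable [NeZero P]

theorem exists_isMatOutput_wienerMat (h : IsSpectralModel μ P p d x D X) :
    ∃ dhat, IsMatOutput μ P x X (wienerMat D X) dhat := by
  choose dhat hd using fun n => h.obs.exists_hasCLIntegral (h.memLp_wienerMat_mulVec_clBasis n)
  exact ⟨dhat, hd⟩

theorem hasMSE (h : IsSpectralModel μ P p d x D X) (hM : IsMatOutput μ P x X M dhat) :
    HasMSE μ d dhat (minPower D X + 1 / P * ∑ n ∈ Finset.range P, (excess D X M n).toReal) := by
  have hper : Function.Periodic (fun n => minErr D X n + (excess D X M n).toReal) P := fun n => by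
    simp only [periodic_minErr D X n, periodic_excess D X M n]
  rw [minPower, ← mul_add, ← Finset.sum_add_distrib]
  simp only [HasMSE, mse, h.integral_norm_sub_sq_eq hM]
  exact tendsto_average_of_periodic hper

theorem hasMSE_wienerMat (h : IsSpectralModel μ P p d x D X)
    (hM : IsMatOutput μ P x X (wienerMat D X) dhat) : HasMSE μ d dhat (minPower D X) := by
  simpa only [excess_wienerMat, ENNReal.toReal_zero, Finset.sum_const_zero, mul_zero, add_zero]
    using h.hasMSE hM

theorem minPower_le (h : IsSpectralModel μ P p d x D X) (hM : IsMatOutput μ P x X M dhat) {L : ℝ}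
    (hL : HasMSE μ d dhat L) : minPower D X ≤ L := by
  rw [tendsto_nhds_unique hL (h.hasMSE hM)]
  exact le_add_of_nonneg_right (by positivity)

theorem ae_eq_wienerMat (h : IsSpectralModel μ P p d x D X) (hM : IsMatOutput μ P x X M dhat)
    (hL : HasMSE μ d dhat (minPower D X)) : M =ᵐ[band P] wienerMat D X := by
  have hP : (1 / P : ℝ) ≠ 0 := one_div_ne_zero (NeZero.ne _)
  have hsum : ∑ n ∈ Finset.range P, (excess D X M n).toReal = 0 :=
    (mul_eq_zero.1 (left_eq_add.1 (tendsto_nhds_unique hL (h.hasMSE hM)))).resolve_left hP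
  have hexcess : ∀ n ∈ Finset.range P, excess D X M n = 0 := fun n hn =>
    ((ENNReal.toReal_eq_zero_iff _).1 ((Finset.sum_eq_zero_iff_of_nonneg fun _ _ =>
      ENNReal.toReal_nonneg).1 hsum n hn)).resolve_right (h.excess_ne_top hM n)
  filter_upwards [(Finset.eventually_all _).2 fun n hn =>
    h.ae_mulVec_clBasis_eq_of_excess_eq_zero hM (hexcess n hn)] with σ hσ
  exact eq_of_mulVec_clBasis_eq hσ

section FilterClasses

variable {ι : Type*} {Out : ι → (ℤ → Ω → ℂ) → Prop} {F : ι → ℝ → Matrix (Fin P) (Fin P) ℂ}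

theorem isLeast_minPower (h : IsSpectralModel μ P p d x D X)
    (hOut : ∀ W dhat, Out W dhat ↔ IsMatOutput μ P x X (F W) dhat)
    (hW : ∃ W, F W =ᵐ[band P] wienerMat D X) :
    IsLeast {L | ∃ W dhat, Out W dhat ∧ HasMSE μ d dhat L} (minPower D X) := by
  constructor
  · obtain ⟨W, hW⟩ := hW
    obtain ⟨dhat, hd⟩ := h.exists_isMatOutput_wienerMat
    exact ⟨W, dhat, (hOut _ _).2 (hd.congr hW.symm), h.hasMSE_wienerMat hd⟩
  · rintro L ⟨W, dhat, hd, hL⟩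
    exact h.minPower_le ((hOut _ _).1 hd) hL

theorem isOptimal_iff (h : IsSpectralModel μ P p d x D X)
    (hOut : ∀ W dhat, Out W dhat ↔ IsMatOutput μ P x X (F W) dhat)
    (hW : ∃ W, F W =ᵐ[band P] wienerMat D X) (W : ι) :
    (∃ dhat L, Out W dhat ∧ HasMSE μ d dhat L ∧
      IsLeast {L | ∃ W dhat, Out W dhat ∧ HasMSE μ d dhat L} L) ↔
      F W =ᵐ[band P] wienerMat D X := by
  have hleast := h.isLeast_minPower hOut hW
  constructor
  · rintro ⟨dhat, L, hd, hL, hmin⟩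
    rw [hmin.unique hleast] at hL
    exact h.ae_eq_wienerMat ((hOut _ _).1 hd) hL
  · intro hF
    obtain ⟨dhat, hd⟩ := h.exists_isMatOutput_wienerMat
    exact ⟨dhat, _, (hOut _ _).2 (hd.congr hF.symm), h.hasMSE_wienerMat hd, hleast⟩

end FilterClasses

theorem minPower_eq (h : IsSpectralModel μ P p d x D X) :
    minPower D X = ∫ σ, (errMat D X σ).trace.re ∂(band P) := by
  have hP : (P : ℝ) ≠ 0 := NeZero.ne _
  rw [minPower]
  simp only [minErr]
  rw [← integral_finsetSum (Finset.range P) fun n _ => h.integrable_quad_errMat n]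
  simp only [sum_quad_clBasis, integral_const_mul]
  rw [one_div, inv_mul_cancel_left₀ hP]

theorem ofReal_minPower_eq (h : IsSpectralModel μ P p d x D X) :
    (minPower D X : ℂ) = ∫ σ, (errMat D X σ).trace ∂(band P) := by
  rw [h.minPower_eq, ← integral_complex_ofReal]
  refine integral_congr_ae ?_
  filter_upwards [h.white] with σ hσ
  exact (Complex.eq_re_of_ofReal_le hσ.sub_mul_inv_mul_posSemidef.trace_nonneg).symm

end IsSpectralModel

section FreshFilters

variable {P : ℕ} [NeZero P]

/-- The matrix response, in the Cramér–Loève domain, of the FRESH filter with the branch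
responses `W`. -/
def freshMat (P : ℕ) (W : Fin P → ℝ → ℂ) (σ : ℝ) : Matrix (Fin P) (Fin P) ℂ :=
  Matrix.of fun j p => conj (W (j - p) (σ + p.val / P))

theorem floor_band_add_mul {σ : ℝ} (hσ : σ ∈ Set.Ico (0 : ℝ) (1 / P)) (k : ℕ) :
    ⌊(σ + k / P) * P⌋₊ = k := by
  have hP : (0 : ℝ) < P := Nat.cast_pos.2 (NeZero.pos P)
  have hσ1 : σ * P < 1 := (lt_div_iff₀ hP).1 hσ.2
  rw [add_mul, div_mul_cancel₀ _ hP.ne', Nat.floor_add_natCast (mul_nonneg hσ.1 hP.le),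
    Nat.floor_eq_zero.2 hσ1, zero_add]

theorem exists_freshMat_ae_eq (M : ℝ → Matrix (Fin P) (Fin P) ℂ) :
    ∃ W, freshMat P W =ᵐ[band P] M := by
  let subband (f : ℝ) : Fin P := Fin.ofNat P ⌊f * P⌋₊
  refine ⟨fun q f => conj (M (f - (subband f).val / P) (subband f + q) (subband f)), ?_⟩
  filter_upwards [ae_restrict_mem measurableSet_Ico] with σ hσ
  ext j p
  have hsubband : subband (σ + p.val / P) = p := by
    simp only [subband, floor_band_add_mul hσ, Fin.ofNat_val_eq_self]
  rw [freshMat, Matrix.of_apply, hsubband, Complex.conj_conj, add_sub_cancel, add_sub_cancel_right]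

variable {Ω : Type*} [MeasurableSpace Ω] {μ : Measure Ω} {p : ℝ} {d x dhat : ℤ → Ω → ℂ}
  {D X DX : ℝ → Matrix (Fin P) (Fin P) ℂ} {W : Fin P → ℝ → ℂ}

theorem isFreshOutput_iff (W : Fin P → ℝ → ℂ) (dhat : ℤ → Ω → ℂ) :
    IsFreshOutput μ P x X W dhat ↔ IsMatOutput μ P x X (freshMat P W) dhat := by
  have hresponse (n : ℤ) : (fun σ j => ∑ p, clBasis P n σ p * conj (W (j - p) (σ + p.val / P))) =
      fun σ => freshMat P W σ *ᵥ clBasis P n σ := by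
    funext σ j
    simp only [freshMat, Matrix.mulVec, dotProduct, Matrix.of_apply, mul_comm]
  simp only [IsFreshOutput, IsMatOutput, hresponse]

namespace IsSpectralModel

theorem isLeast_freshMSEs (h : IsSpectralModel μ P p d x D X) :
    IsLeast (freshMSEs μ P d x X) (minPower D X) :=
  h.isLeast_minPower isFreshOutput_iff (exists_freshMat_ae_eq _)

theorem isCyclicWiener_iff_ae_eq (h : IsSpectralModel μ P p d x D X) :
    IsCyclicWiener μ P d x X W ↔ freshMat P W =ᵐ[band P] wienerMat D X :=
  h.isOptimal_iff isFreshOutput_iff (exists_freshMat_ae_eq _) W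

theorem isFreshOutput_iff_of_isCyclicWiener (h : IsSpectralModel μ P p d x D X)
    (hW : IsCyclicWiener μ P d x X W) :
    IsFreshOutput μ P x X W dhat ↔ IsMatOutput μ P x X (wienerMat D X) dhat :=
  (isFreshOutput_iff W dhat).trans (isMatOutput_congr_ae (h.isCyclicWiener_iff_ae_eq.1 hW))

theorem isCyclicWiener_iff (h : IsSpectralModel μ P p d x D X) (hDX : DX =ᵐ[band P] D) :
    IsCyclicWiener μ P d x X W ↔ ∀ p q : Fin P, ∀ᵐ σ ∂(band P),
      W q (σ + p.val / P) = ((X σ)⁻¹ * (DX σ)ᴴ) (p + q) p := by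
  rw [h.isCyclicWiener_iff_ae_eq]
  simp only [← ae_all_iff]
  refine eventually_congr ?_
  filter_upwards [h.white, hDX] with σ hσ hDXσ
  have hwiener (i j : Fin P) : wienerMat D X σ i j = conj (((X σ)⁻¹ * (DX σ)ᴴ) i j) := by
    rw [hDXσ, hσ.posSemidef.isHermitian.eq, ← hσ.conjTranspose_mul_inv]
    exact (star_star _).symm
  simp only [← Matrix.ext_iff, hwiener, freshMat, Matrix.of_apply,
    (starRingEnd ℂ).injective.eq_iff]
  exact ⟨fun hW p q => by simpa only [add_sub_cancel_left] using hW (p + q) p,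
    fun hW j p => by rw [hW, add_sub_cancel]⟩

end IsSpectralModel

end FreshFilters

section Eigenbasis

open Unitary (conjStarAlgAut conjStarAlgAut_symm_apply)

variable {n : Type*} [Fintype n] [DecidableEq n] {p : ℝ} {A X : Matrix n n ℂ}
  {U : Matrix.unitaryGroup n ℂ} {dv ev : n → ℝ}

theorem conjStarAlgAut_symm_eq_diagonal (h : ∀ q, X *ᵥ U.valᵀ q = (ev q : ℂ) • U.valᵀ q) :
    (conjStarAlgAut ℂ _ U).symm X = Matrix.diagonal fun q => (ev q : ℂ) := by
  have hXU : X * U.val = U.val * Matrix.diagonal fun q => (ev q : ℂ) := by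
    ext i q
    rw [Matrix.mul_diagonal, mul_comm]
    exact congrFun (h q) i
  rw [conjStarAlgAut_symm_apply, mul_assoc, hXU, ← mul_assoc, Unitary.coe_star_mul_self, one_mul]

theorem trace_conjStarAlgAut_symm (K : Matrix n n ℂ) (U : Matrix.unitaryGroup n ℂ) :
    ((conjStarAlgAut ℂ _ U).symm K).trace = K.trace := by
  rw [conjStarAlgAut_symm_apply, Matrix.trace_mul_comm, ← mul_assoc,
    Unitary.mul_star_self_of_mem U.2, one_mul]

theorem IsWhitePair.exists_eigenvalue (h : IsWhitePair p A X) {b : n → n → ℂ}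
    (hev : ∀ q, X *ᵥ b q = (ev q : ℂ) • b q) :
    ∃ dv : n → ℝ, ∀ q, A *ᵥ b q = (dv q : ℂ) • b q := by
  rcases h.white with hw | hw
  · refine ⟨fun _ => p, fun q => ?_⟩
    rw [hw, Matrix.smul_mulVec, Matrix.one_mulVec]
  · refine ⟨fun q => ev q - p, fun q => ?_⟩
    rw [← sub_sub_cancel X A, hw, Matrix.sub_mulVec, hev, Matrix.smul_mulVec, Matrix.one_mulVec,
      ← sub_smul, Complex.ofReal_sub]

/-- The columns of `U` diagonalise a signal spectral matrix `A` and an invertible observation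
spectral matrix `X`, with the eigenvalues `dv` and `ev`. -/
structure IsCommonEigenbasis (A X : Matrix n n ℂ) (U : Matrix.unitaryGroup n ℂ) (dv ev : n → ℝ) :
    Prop where
  signal : (conjStarAlgAut ℂ _ U).symm A = Matrix.diagonal fun q => (dv q : ℂ)
  obs : (conjStarAlgAut ℂ _ U).symm X = Matrix.diagonal fun q => (ev q : ℂ)
  isUnit_obs : IsUnit X

theorem IsWhitePair.exists_isCommonEigenbasis (h : IsWhitePair p A X)
    (hev : ∀ q, X *ᵥ U.valᵀ q = (ev q : ℂ) • U.valᵀ q) :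
    ∃ dv : n → ℝ, IsCommonEigenbasis A X U dv ev := by
  obtain ⟨dv, hdv⟩ := h.exists_eigenvalue hev
  exact ⟨dv, conjStarAlgAut_symm_eq_diagonal hdv, conjStarAlgAut_symm_eq_diagonal hev,
    h.posDef.isUnit⟩

namespace IsCommonEigenbasis

theorem obs_ne_zero (h : IsCommonEigenbasis A X U dv ev) (q : n) : (ev q : ℂ) ≠ 0 := by
  have hdiag := h.isUnit_obs.map (conjStarAlgAut ℂ (Matrix n n ℂ) U).symm
  rw [h.obs, Matrix.isUnit_diagonal, Pi.isUnit_iff] at hdiag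
  exact (hdiag q).ne_zero

theorem mul_inv (h : IsCommonEigenbasis A X U dv ev) :
    (conjStarAlgAut ℂ _ U).symm (A * X⁻¹) = Matrix.diagonal fun q => (dv q / ev q : ℂ) := by
  have hmul : (conjStarAlgAut ℂ _ U).symm (A * X⁻¹) * Matrix.diagonal (fun q => (ev q : ℂ)) =
      Matrix.diagonal fun q => (dv q : ℂ) := by
    rw [← h.obs, ← map_mul, Matrix.nonsing_inv_mul_cancel_right _ _
      ((Matrix.isUnit_iff_isUnit_det X).1 h.isUnit_obs), h.signal]
  ext i q
  have hiq := congrFun₂ hmul i q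
  rw [Matrix.mul_diagonal, ← eq_div_iff (h.obs_ne_zero q)] at hiq
  rcases eq_or_ne i q with rfl | hne
  · rw [hiq, Matrix.diagonal_apply_eq, Matrix.diagonal_apply_eq]
  · rw [hiq, Matrix.diagonal_apply_ne _ hne, Matrix.diagonal_apply_ne _ hne, zero_div]

theorem sub_mul_inv_mul (h : IsCommonEigenbasis A X U dv ev) :
    (conjStarAlgAut ℂ _ U).symm (A - A * X⁻¹ * A) =
      Matrix.diagonal fun q => (dv q - dv q ^ 2 / ev q : ℂ) := by
  rw [map_sub, map_mul, h.mul_inv, h.signal, Matrix.diagonal_mul_diagonal, Matrix.diagonal_sub]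
  congr 1 with q
  ring

theorem conjStarAlgAut_diagonal_eq_iff (h : IsCommonEigenbasis A X U dv ev) (w : n → ℂ) :
    conjStarAlgAut ℂ _ U (Matrix.diagonal fun q => conj (w q)) = A * X⁻¹ ↔
      ∀ q, w q = conj ((conjStarAlgAut ℂ _ U).symm A q q) / (conjStarAlgAut ℂ _ U).symm X q q := by
  rw [← StarAlgEquiv.eq_symm_apply, h.mul_inv, h.signal, h.obs, Matrix.diagonal_eq_diagonal_iff]
  refine forall_congr' fun q => ?_
  rw [Matrix.diagonal_apply_eq, Matrix.diagonal_apply_eq, ← (starRingEnd ℂ).injective.eq_iff]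
  simp

theorem mul_one_sub_coherence (h : IsCommonEigenbasis A X U dv ev) (q : n) :
    ((conjStarAlgAut ℂ _ U).symm A q q).re * (1 - ‖(conjStarAlgAut ℂ _ U).symm A q q‖ ^ 2 /
      (((conjStarAlgAut ℂ _ U).symm X q q).re * ((conjStarAlgAut ℂ _ U).symm A q q).re)) =
      ((conjStarAlgAut ℂ _ U).symm (A - A * X⁻¹ * A) q q).re := by
  have hev : ev q ≠ 0 := by exact_mod_cast h.obs_ne_zero q
  have hre : ((dv q : ℂ) - dv q ^ 2 / ev q).re = dv q - dv q ^ 2 / ev q := by norm_cast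
  simp only [h.sub_mul_inv_mul, h.signal, h.obs, Matrix.diagonal_apply_eq, Complex.ofReal_re,
    Complex.norm_real, Real.norm_eq_abs, sq_abs, hre]
  rcases eq_or_ne (dv q) 0 with h0 | h0
  · simp [h0]
  · field_simp

end IsCommonEigenbasis

end Eigenbasis

section KLFilters

variable {P : ℕ} {D X DX B K : ℝ → Matrix (Fin P) (Fin P) ℂ}

theorem IsKLBasis.ae_mem_unitaryGroup (hB : IsKLBasis P X B) :
    ∀ᵐ σ ∂(band P), B σ ∈ Matrix.unitaryGroup (Fin P) ℂ := by
  filter_upwards [hB.2] with σ hσ using hσ.1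

theorem IsKLBasis.diagonal_klSpec_ae_eq (hB : IsKLBasis P X B) :
    (fun σ => Matrix.diagonal fun q => klSpec P X B q σ) =ᵐ[band P]
      fun σ => (B σ)ᴴ * X σ * B σ := by
  filter_upwards [hB.2] with σ ⟨hU, ev, hev⟩
  have hdiag : (B σ)ᴴ * X σ * B σ = Matrix.diagonal fun q => (ev q : ℂ) :=
    conjStarAlgAut_symm_eq_diagonal (U := ⟨B σ, hU⟩) hev
  simp only [klSpec, hdiag, Matrix.diagonal_apply_eq]

theorem quad_transpose_mulVec {n : Type*} [Fintype n] [DecidableEq n] {U : Matrix n n ℂ}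
    (hU : U ∈ Matrix.unitaryGroup n ℂ) (K : Matrix n n ℂ) (v : n → ℂ) :
    quad (Uᴴ * K * U) (Uᵀ *ᵥ v) = quad K v := by
  have hUU : U * Uᴴ = 1 := Matrix.mem_unitaryGroup_iff.1 hU
  have hstar : star (Uᵀ *ᵥ v) = Uᴴ *ᵥ star v := by
    rw [Matrix.star_mulVec, ← Matrix.mulVec_transpose]
    rfl
  rw [quad, hstar, Matrix.mulVec_mulVec, mul_assoc, hUU, mul_one, Matrix.mulVec_transpose,
    ← Matrix.dotProduct_mulVec, Matrix.mulVec_mulVec, ← mul_assoc, hUU, one_mul, quad]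

theorem transpose_mulVec_conjTranspose_transpose_mulVec {n : Type*} [Fintype n] [DecidableEq n]
    {U : Matrix n n ℂ} (hU : U ∈ Matrix.unitaryGroup n ℂ) (v : n → ℂ) :
    Uᵀ *ᵥ (Uᴴᵀ *ᵥ v) = v := by
  have hUU : Uᴴ * U = 1 := Matrix.mem_unitaryGroup_iff'.1 hU
  rw [Matrix.mulVec_mulVec, ← Matrix.transpose_mul, hUU, Matrix.transpose_one, Matrix.one_mulVec]

theorem linearCombination_klBasis_apply (B : ℝ → Matrix (Fin P) (Fin P) ℂ) (c : ℤ →₀ ℂ) (σ : ℝ) :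
    linearCombination ℂ (klBasis P B) c σ =
      (B σ)ᵀ *ᵥ linearCombination ℂ (clBasis P) c σ := by
  have hbasis (n : ℤ) : klBasis P B n σ = (B σ)ᵀ *ᵥ clBasis P n σ := rfl
  simp only [linearCombination_apply, Finsupp.sum, Finset.sum_apply, Pi.smul_apply, hbasis,
    Matrix.mulVec_sum, Matrix.mulVec_smul]

theorem IsKLBasis.kernelNorm_sub_linearCombination (hB : IsKLBasis P X B) (u : ℝ → Fin P → ℂ)
    (c : ℤ →₀ ℂ) :
    kernelNorm (band P) (fun σ => Matrix.diagonal fun q => klSpec P X B q σ)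
        (u - linearCombination ℂ (klBasis P B) c) =
      kernelNorm (band P) X
        ((fun σ => (B σ)ᴴᵀ *ᵥ u σ) - linearCombination ℂ (clBasis P) c) := by
  refine eLpNorm_congr_ae ?_
  filter_upwards [hB.ae_mem_unitaryGroup, hB.diagonal_klSpec_ae_eq] with σ hU hdiag
  simp only [hdiag, Pi.sub_apply]
  rw [linearCombination_klBasis_apply,
    ← transpose_mulVec_conjTranspose_transpose_mulVec hU (u σ), ← Matrix.mulVec_sub,
    quad_transpose_mulVec hU, transpose_mulVec_conjTranspose_transpose_mulVec hU]

theorem IsKLBasis.aestronglyMeasurable_mulVec_iff (hB : IsKLBasis P X B) {u : ℝ → Fin P → ℂ} :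
    AEStronglyMeasurable (fun σ => (B σ)ᴴᵀ *ᵥ u σ) (band P) ↔
      AEStronglyMeasurable u (band P) := by
  refine ⟨fun hu => ?_, aestronglyMeasurable_mulVec fun i j =>
    continuous_star.measurable.comp_aemeasurable (hB.1 i j)⟩
  refine (aestronglyMeasurable_mulVec (fun i j => hB.1 j i) hu).congr ?_
  filter_upwards [hB.ae_mem_unitaryGroup] with σ hU
  exact transpose_mulVec_conjTranspose_transpose_mulVec hU (u σ)

variable {Ω : Type*} [MeasurableSpace Ω] {μ : Measure Ω} {p : ℝ} {d x dhat : ℤ → Ω → ℂ}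
  {W : Fin P → ℝ → ℂ}

theorem IsKLBasis.hasKLIntegral_iff (hB : IsKLBasis P X B) {u : ℝ → Fin P → ℂ} {Y : Ω → ℂ} :
    HasKLIntegral μ P x X B u Y ↔ HasCLIntegral μ P x X (fun σ => (B σ)ᴴᵀ *ᵥ u σ) Y := by
  simp only [HasKLIntegral, HasCLIntegral, hasSpectralIntegral_iff,
    hB.aestronglyMeasurable_mulVec_iff, hB.kernelNorm_sub_linearCombination]

/-- The matrix response, in the Cramér–Loève domain, of the scalar filter `W` in the KL domain. -/
def klMat (P : ℕ) (B : ℝ → Matrix (Fin P) (Fin P) ℂ) (W : Fin P → ℝ → ℂ) (σ : ℝ) :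
    Matrix (Fin P) (Fin P) ℂ :=
  (B σ * (Matrix.diagonal fun p => conj (W p σ)) * (B σ)ᴴ)ᵀ

theorem isKLOutput_iff (hB : IsKLBasis P X B) (W : Fin P → ℝ → ℂ) (dhat : ℤ → Ω → ℂ) :
    IsKLOutput μ P x X B W dhat ↔ IsMatOutput μ P x X (klMat P B W) dhat := by
  have hresponse (n : ℤ) (σ : ℝ) : (B σ)ᴴᵀ *ᵥ (fun p => klBasis P B n σ p * conj (W p σ)) =
      klMat P B W σ *ᵥ clBasis P n σ := by
    have hscale : (Matrix.diagonal fun p => conj (W p σ)) *ᵥ klBasis P B n σ =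
        fun p => klBasis P B n σ p * conj (W p σ) :=
      funext fun p => by rw [Matrix.mulVec_diagonal, mul_comm]
    rw [klMat, Matrix.transpose_mul, Matrix.transpose_mul, Matrix.diagonal_transpose,
      ← Matrix.mulVec_mulVec, ← Matrix.mulVec_mulVec, ← hscale]
    rfl
  simp only [IsKLOutput, IsMatOutput, hB.hasKLIntegral_iff, hresponse]

theorem integrable_klSpec (hK : ∀ i j, Integrable (K · i j) (band P)) (hB : IsKLBasis P X B)
    (q : Fin P) : Integrable (klSpec P K B q) (band P) := by
  have hb (i j : Fin P) : MemLp (B · i j) ∞ (band P) :=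
    memLp_top_of_bound (hB.1 i j).aestronglyMeasurable 1 <| by
      filter_upwards [hB.ae_mem_unitaryGroup] with σ hU using entry_norm_bound_of_unitary hU i j
  unfold klSpec
  simp only [Matrix.mul_apply, Matrix.conjTranspose_apply]
  exact integrable_finsetSum _ fun j _ => Integrable.mul_of_top_left
    (integrable_finsetSum _ fun i _ => (hK i j).mul_of_top_right (hb i q).star) (hb j q)

namespace IsSpectralModel

theorem isKLBasis_signal (h : IsSpectralModel μ P p d x D X) (hB : IsKLBasis P X B) :
    IsKLBasis P D B := by
  refine ⟨hB.1, ?_⟩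
  filter_upwards [h.white, hB.2] with σ hσ ⟨hU, ev, hev⟩ using ⟨hU, hσ.exists_eigenvalue hev⟩

theorem ae_isCommonEigenbasis (h : IsSpectralModel μ P p d x D X) (hB : IsKLBasis P X B) :
    ∀ᵐ σ ∂(band P), ∃ U : Matrix.unitaryGroup (Fin P) ℂ, U.val = B σ ∧
      ∃ dv ev, IsCommonEigenbasis (D σ) (X σ) U dv ev := by
  filter_upwards [h.white, hB.2] with σ hσ ⟨hU, ev, hev⟩
  obtain ⟨dv, hdv⟩ := hσ.exists_isCommonEigenbasis (U := ⟨B σ, hU⟩) hev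
  exact ⟨⟨B σ, hU⟩, rfl, dv, ev, hdv⟩

theorem klMat_ae_eq_iff (h : IsSpectralModel μ P p d x D X) (hB : IsKLBasis P X B)
    (hDX : DX =ᵐ[band P] D) :
    klMat P B W =ᵐ[band P] wienerMat D X ↔
      ∀ p, ∀ᵐ σ ∂(band P), W p σ = conj (klSpec P DX B p σ) / klSpec P X B p σ := by
  rw [← ae_all_iff]
  refine eventually_congr ?_
  filter_upwards [h.ae_isCommonEigenbasis hB, hDX] with σ ⟨U, hU, dv, ev, heig⟩ hDXσ
  rw [klMat, wienerMat, Matrix.transpose_inj]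
  simp only [klSpec, hDXσ, ← hU]
  exact heig.conjStarAlgAut_diagonal_eq_iff _

theorem exists_klMat_ae_eq (h : IsSpectralModel μ P p d x D X) (hB : IsKLBasis P X B) :
    ∃ W, klMat P B W =ᵐ[band P] wienerMat D X :=
  ⟨fun p σ => conj (klSpec P D B p σ) / klSpec P X B p σ,
    (h.klMat_ae_eq_iff hB EventuallyEq.rfl).2 fun _ => EventuallyEq.rfl⟩

theorem klSpec_mul_one_sub_klCohSq_ae_eq (h : IsSpectralModel μ P p d x D X)
    (hB : IsKLBasis P X B) (hDX : DX =ᵐ[band P] D) (q : Fin P) :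
    (fun σ => (klSpec P D B q σ).re * (1 - klCohSq P D X DX B q σ)) =ᵐ[band P]
      fun σ => (klSpec P (errMat D X) B q σ).re := by
  filter_upwards [h.ae_isCommonEigenbasis hB, hDX] with σ ⟨U, hU, dv, ev, heig⟩ hDXσ
  simp only [klCohSq, klSpec, hDXσ, ← hU]
  exact heig.mul_one_sub_coherence q

theorem integrable_klSpec_mul_one_sub_klCohSq (h : IsSpectralModel μ P p d x D X)
    (hB : IsKLBasis P X B) (hDX : DX =ᵐ[band P] D) (q : Fin P) :
    Integrable (fun σ => (klSpec P D B q σ).re * (1 - klCohSq P D X DX B q σ)) (band P) :=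
  (integrable_klSpec h.integrable_errMat hB q).re.congr
    (h.klSpec_mul_one_sub_klCohSq_ae_eq hB hDX q).symm

variable [NeZero P]

theorem isLeast_klMSEs (h : IsSpectralModel μ P p d x D X) (hB : IsKLBasis P X B) :
    IsLeast (klMSEs μ P d x X B) (minPower D X) :=
  h.isLeast_minPower (isKLOutput_iff hB) (h.exists_klMat_ae_eq hB)

theorem isKLWiener_iff_ae_eq (h : IsSpectralModel μ P p d x D X) (hB : IsKLBasis P X B) :
    IsKLWiener μ P d x X B W ↔ klMat P B W =ᵐ[band P] wienerMat D X :=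
  h.isOptimal_iff (isKLOutput_iff hB) (h.exists_klMat_ae_eq hB) W

theorem isKLWiener_iff (h : IsSpectralModel μ P p d x D X) (hB : IsKLBasis P X B)
    (hDX : DX =ᵐ[band P] D) : IsKLWiener μ P d x X B W ↔
      ∀ p, ∀ᵐ σ ∂(band P), W p σ = conj (klSpec P DX B p σ) / klSpec P X B p σ :=
  (h.isKLWiener_iff_ae_eq hB).trans (h.klMat_ae_eq_iff hB hDX)

theorem isKLOutput_iff_of_isKLWiener (h : IsSpectralModel μ P p d x D X) (hB : IsKLBasis P X B)
    (hW : IsKLWiener μ P d x X B W) :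
    IsKLOutput μ P x X B W dhat ↔ IsMatOutput μ P x X (wienerMat D X) dhat :=
  (isKLOutput_iff hB W dhat).trans (isMatOutput_congr_ae ((h.isKLWiener_iff_ae_eq hB).1 hW))

theorem minPower_eq_sum_integral_klSpec (h : IsSpectralModel μ P p d x D X)
    (hB : IsKLBasis P X B) (hDX : DX =ᵐ[band P] D) :
    minPower D X =
      ∑ q, ∫ σ, (klSpec P D B q σ).re * (1 - klCohSq P D X DX B q σ) ∂(band P) := by
  rw [← integral_finsetSum Finset.univ fun q _ =>
    h.integrable_klSpec_mul_one_sub_klCohSq hB hDX q, h.minPower_eq]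
  refine integral_congr_ae ?_
  filter_upwards [hB.ae_mem_unitaryGroup, ae_all_iff.2 (h.klSpec_mul_one_sub_klCohSq_ae_eq hB hDX)]
    with σ hU hσ
  rw [Finset.sum_congr rfl fun q _ => hσ q, ← Complex.re_sum,
    ← trace_conjStarAlgAut_symm (errMat D X σ) ⟨B σ, hU⟩]
  rfl

end IsSpectralModel

end KLFilters

section Coherence

variable {P : ℕ} {p : ℝ} {A X : Matrix (Fin P) (Fin P) ℂ}

theorem continuousOn_spectrum (A : Matrix (Fin P) (Fin P) ℂ) (f : ℝ → ℝ) :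
    ContinuousOn f (spectrum ℝ A) :=
  (Matrix.finite_real_spectrum (A := A)).continuousOn f

theorem conjTranspose_invSqrt (A : Matrix (Fin P) (Fin P) ℂ) : (invSqrt A)ᴴ = invSqrt A :=
  (cfc_predicate (p := IsSelfAdjoint) (fun t : ℝ => (√t)⁻¹) A).star_eq

open scoped MatrixOrder in
theorem mul_invSqrt_mul_self_mul_invSqrt (hA : A.PosSemidef) :
    A * (invSqrt A * A * invSqrt A) = A := by
  have hsa : IsSelfAdjoint A := hA.isHermitian
  have hc := continuousOn_spectrum A
  have hcfc : A * (invSqrt A * A * invSqrt A) =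
      cfc (fun t : ℝ => t * ((√t)⁻¹ * t * (√t)⁻¹)) A := by
    rw [cfc_mul _ _ A (hc _) (hc _), cfc_mul _ _ A (hc _) (hc _), cfc_mul _ _ A (hc _) (hc _),
      cfc_id' ℝ A hsa]
    rfl
  rw [hcfc]
  conv_rhs => rw [← cfc_id' ℝ A hsa]
  refine cfc_congr fun t ht => ?_
  have hsq : √t * √t = t := Real.mul_self_sqrt (spectrum_nonneg_of_nonneg hA.nonneg ht)
  rcases eq_or_ne t 0 with rfl | ht0
  · simp
  · have : √t ≠ 0 := fun h => ht0 (by rw [← hsq, h, mul_zero])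
    field_simp
    rw [sq, hsq]

open scoped MatrixOrder in
theorem invSqrt_mul_invSqrt (hX : X.PosDef) : invSqrt X * invSqrt X = X⁻¹ := by
  have hsa : IsSelfAdjoint X := hX.isHermitian
  have hc := continuousOn_spectrum X
  have hcfc : X * (invSqrt X * invSqrt X) = cfc (fun t : ℝ => t * ((√t)⁻¹ * (√t)⁻¹)) X := by
    rw [cfc_mul _ _ X (hc _) (hc _), cfc_mul _ _ X (hc _) (hc _), cfc_id' ℝ X hsa]
    rfl
  refine (Matrix.inv_eq_right_inv ?_).symm
  rw [hcfc, ← cfc_const_one ℝ X hsa]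
  refine cfc_congr fun t ht => ?_
  have htpos : 0 < t := (Matrix.isStrictlyPositive_iff_posDef.2 hX).spectrum_pos ht
  simp only [← mul_inv, Real.mul_self_sqrt htpos.le, mul_inv_cancel₀ htpos.ne']

namespace IsWhitePair

theorem trace_mul_one_sub_cohMat (h : IsWhitePair p A X) :
    (A * (1 - cohMat A A X * (cohMat A A X)ᴴ)).trace = (A - A * X⁻¹ * A).trace := by
  have hcoh : cohMat A A X * (cohMat A A X)ᴴ = invSqrt A * (A * X⁻¹ * A) * invSqrt A := by
    rw [cohMat, Matrix.conjTranspose_mul, Matrix.conjTranspose_mul, conjTranspose_invSqrt,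
      conjTranspose_invSqrt, h.posSemidef.isHermitian.eq, ← invSqrt_mul_invSqrt h.posDef]
    noncomm_ring
  have hassoc : A * (invSqrt A * (A * X⁻¹ * A) * invSqrt A) =
      A * invSqrt A * (A * X⁻¹) * (A * invSqrt A) := by noncomm_ring
  have hassoc' : A * invSqrt A * (A * invSqrt A * (A * X⁻¹)) =
      A * (invSqrt A * A * invSqrt A) * (A * X⁻¹) := by noncomm_ring
  rw [mul_sub, mul_one, Matrix.trace_sub, Matrix.trace_sub, hcoh, hassoc, Matrix.trace_mul_comm,
    hassoc', mul_invSqrt_mul_self_mul_invSqrt h.posSemidef, Matrix.trace_mul_comm A]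

theorem sub_mul_inv_mul_eq_smul (h : IsWhitePair p A X) {r : ℝ} (hr : X - A = (r : ℂ) • 1) :
    A - A * X⁻¹ * A = (r : ℂ) • (A * X⁻¹) := by
  nth_rewrite 1 [← h.mul_inv_mul_cancel]
  rw [← mul_sub, hr, mul_smul_comm, mul_one]

end IsWhitePair

end Coherence

section Correlation

variable {Ω : Type*} [MeasurableSpace Ω] {μ : Measure Ω} {x y z : ℤ → Ω → ℂ}

theorem corr_sub (x y : ℤ → Ω → ℂ) (n m : ℤ) :
    corr μ x y m (n - m) = ∫ ω, x n ω * conj (y m ω) ∂μ := by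
  rw [corr, add_sub_cancel]

theorem corr_eq_zero_iff : corr μ x y = 0 ↔ ∀ n m, ∫ ω, x n ω * conj (y m ω) ∂μ = 0 := by
  refine ⟨fun h n m => ?_, fun h => funext₂ fun n m => h (n + m) n⟩
  rw [← corr_sub, h]
  rfl

theorem corr_eq_zero_comm : corr μ x y = 0 ↔ corr μ y x = 0 := by
  have hconj (n m : ℤ) : ∫ ω, y m ω * conj (x n ω) ∂μ = conj (∫ ω, x n ω * conj (y m ω) ∂μ) := by
    simp only [← integral_conj, map_mul, Complex.conj_conj, mul_comm]
  simp only [corr_eq_zero_iff, hconj, map_eq_zero]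
  exact forall_comm

theorem corr_add_left (hx : ∀ n, MemLp (x n) 2 μ) (hy : ∀ n, MemLp (y n) 2 μ)
    (hz : ∀ n, MemLp (z n) 2 μ) : corr μ (x + y) z = corr μ x z + corr μ y z := by
  ext n m
  simp only [corr, Pi.add_apply, add_mul]
  exact integral_add (integrable_mul_conj (hx _) (hz _)) (integrable_mul_conj (hy _) (hz _))

theorem corr_add_right (hx : ∀ n, MemLp (x n) 2 μ) (hy : ∀ n, MemLp (y n) 2 μ)
    (hz : ∀ n, MemLp (z n) 2 μ) : corr μ x (y + z) = corr μ x y + corr μ x z := by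
  ext n m
  simp only [corr, Pi.add_apply, map_add, mul_add]
  exact integral_add (integrable_mul_conj (hx _) (hy _)) (integrable_mul_conj (hx _) (hz _))

theorem corr_add_right_of_uncorrelated (hx : ∀ n, MemLp (x n) 2 μ) (hz : ∀ n, MemLp (z n) 2 μ)
    (h : corr μ x z = 0) : corr μ x (x + z) = corr μ x x := by
  rw [corr_add_right hx hx hz, h, add_zero]

theorem corr_add_self_of_uncorrelated (hx : ∀ n, MemLp (x n) 2 μ) (hz : ∀ n, MemLp (z n) 2 μ)
    (h : corr μ x z = 0) : corr μ (x + z) (x + z) = corr μ x x + corr μ z z := by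
  rw [corr_add_left (z := x + z) hx hz fun n => (hx n).add (hz n),
    corr_add_right_of_uncorrelated hx hz h, corr_add_right hz hx hz, corr_eq_zero_comm.1 h,
    zero_add]

end Correlation

section Cyclostationary

variable {Ω : Type*} [MeasurableSpace Ω] {μ : Measure Ω} {P : ℕ} {d x z : ℤ → Ω → ℂ}
  {S sD sX : ℤ → ℝ → ℂ} {p : ℝ}

theorem IsCyclostationary.periodic_corr (hx : IsCyclostationary μ P x) (m : ℤ) :
    Function.Periodic (fun n => corr μ x x n m) P := fun n => by simpa using hx.2 n m 1

theorem IsCyclostationary.add (hd : IsCyclostationary μ P d) (hz : IsCyclostationary μ P z)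
    (hdz : corr μ d z = 0) : IsCyclostationary μ P (d + z) := by
  refine ⟨fun n => (hd.1 n).add (hz.1 n), fun n m l => ?_⟩
  simp only [corr_add_self_of_uncorrelated hd.1 hz.1 hdz, Pi.add_apply, hd.2, hz.2]

theorem integral_cexp2pi_mul_intCast (m : ℤ) :
    ∫ f in Set.Ico (0 : ℝ) 1, cexp2pi (f * m) = if m = 0 then 1 else 0 := by
  split_ifs with hm
  · simp [hm, cexp2pi_zero]
  have hc : (2 * Real.pi * Complex.I * m : ℂ) ≠ 0 := by simp [Real.pi_ne_zero, hm]
  have hexp (f : ℝ) : cexp2pi (f * m) = Complex.exp (2 * Real.pi * Complex.I * m * f) := by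
    rw [cexp2pi, Complex.ofReal_mul, Complex.ofReal_intCast, mul_assoc _ (m : ℂ), mul_comm (m : ℂ)]
  have hone : Complex.exp (2 * Real.pi * Complex.I * m * (1 : ℝ)) = 1 := by
    rw [← hexp, one_mul, cexp2pi_intCast]
  simp only [hexp]
  rw [integral_Ico_eq_integral_Ioc, ← intervalIntegral.integral_of_le zero_le_one,
    integral_exp_mul_complex hc, hone]
  simp

theorem isCyclicSpectrum_noise (hd : ∀ n, MemLp (d n) 2 μ) (hz : ∀ n, MemLp (z n) 2 μ)
    (hdz : corr μ d z = 0) (hsD : IsCyclicSpectrum P (corr μ d d) sD)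
    (hsX : IsCyclicSpectrum P (corr μ (d + z) (d + z)) sX) :
    IsCyclicSpectrum P (corr μ z z) (sX - sD) := by
  have hcorr : corr μ z z = corr μ (d + z) (d + z) - corr μ d d := by
    rw [corr_add_self_of_uncorrelated hd hz hdz, add_sub_cancel_left]
  exact hcorr ▸ hsX.sub hsD

variable [NeZero P]

theorem IsCyclostationary.hasSpectralMatrix (hx : IsCyclostationary μ P x)
    (hS : IsCyclicSpectrum P (corr μ x x) S) : HasSpectralMatrix μ P x (cycMat P S) where
  memLp := hx.1
  integrable := hS.integrable_cycMat
  moment n m := by rw [← corr_sub, hS.moment hx.periodic_corr]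

theorem isCyclicSpectrum_white (P : ℕ) [NeZero P] (p : ℝ) :
    IsCyclicSpectrum P (fun _ m => if m = 0 then (p : ℂ) else 0)
      (fun k _ => if (P : ℤ) ∣ k then (p : ℂ) else 0) := by
  have hP : (P : ℂ) ≠ 0 := NeZero.ne _
  refine ⟨fun k => integrableOn_const (by simp), fun k m => ?_⟩
  have hsum : ∑ n ∈ Finset.range P, cexp2pi (-((k : ℝ) * n / P)) =
      if (P : ℤ) ∣ k then (P : ℂ) else 0 := by
    rw [← if_congr (dvd_neg (α := ℤ) (b := k)) rfl rfl, ← sum_range_cexp2pi]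
    refine Finset.sum_congr rfl fun n _ => ?_
    congr 1
    push_cast
    ring
  simp only
  rw [← Finset.mul_sum, hsum, integral_const_mul, integral_cexp2pi_mul_intCast]
  split_ifs <;> simp [hP, mul_comm (p : ℂ)]

theorem cycMat_white (P : ℕ) (p : ℝ) :
    cycMat P (fun k _ => if (P : ℤ) ∣ k then (p : ℂ) else 0) = fun _ => (p : ℂ) • 1 := by
  have hdvd (i j : Fin P) : (P : ℤ) ∣ (i.val : ℤ) - (j.val : ℤ) ↔ i = j := by
    refine ⟨fun h => ?_, by rintro rfl; simp⟩
    have := Int.eq_zero_of_abs_lt_dvd h (by rw [abs_lt]; omega)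
    omega
  ext σ i j
  simp only [cycMat, Matrix.of_apply, Matrix.smul_apply, Matrix.one_apply, hdvd, smul_eq_mul,
    mul_ite, mul_one, mul_zero]

theorem IsWhite.cycMat_ae_eq (hx : IsWhite μ p x) (hS : IsCyclicSpectrum P (corr μ x x) S) :
    cycMat P S =ᵐ[band P] fun _ => (p : ℂ) • 1 := by
  rw [← cycMat_white P p]
  refine IsCyclicSpectrum.cycMat_ae_eq hS ?_
  rw [funext₂ hx.2]
  exact isCyclicSpectrum_white P p

theorem cycMat_cross_ae_eq (hd : ∀ n, MemLp (d n) 2 μ) (hz : ∀ n, MemLp (z n) 2 μ)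
    (hdz : corr μ d z = 0) (hsD : IsCyclicSpectrum P (corr μ d d) sD)
    (hsDX : IsCyclicSpectrum P (corr μ d (d + z)) S) : cycMat P S =ᵐ[band P] cycMat P sD := by
  rw [corr_add_right_of_uncorrelated hd hz hdz] at hsDX
  exact hsDX.cycMat_ae_eq hsD

theorem isSpectralModel_cycMat (hd : IsCyclostationary μ P d) (hz : IsCyclostationary μ P z)
    (hp : 0 < p) (hwhite : IsWhite μ p z ∨ IsWhite μ p d) (hdz : corr μ d z = 0)
    (hsD : IsCyclicSpectrum P (corr μ d d) sD)
    (hsX : IsCyclicSpectrum P (corr μ (d + z) (d + z)) sX) :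
    IsSpectralModel μ P p d (d + z) (cycMat P sD) (cycMat P sX) := by
  have hsZ := isCyclicSpectrum_noise hd.1 hz.1 hdz hsD hsX
  have hwhite' : ∀ᵐ σ ∂(band P), cycMat P sD σ = (p : ℂ) • 1 ∨
      cycMat P (sX - sD) σ = (p : ℂ) • 1 := by
    rcases hwhite with hw | hw
    · filter_upwards [hw.cycMat_ae_eq hsZ] with σ hσ using .inr hσ
    · filter_upwards [hw.cycMat_ae_eq hsD] with σ hσ using .inl hσ
  refine ⟨hd.hasSpectralMatrix hsD, (hd.add hz hdz).hasSpectralMatrix hsX, fun n m => ?_, ?_⟩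
  · rw [← hsD.moment hd.periodic_corr, ← corr_add_right_of_uncorrelated hd.1 hz.1 hdz, corr_sub]
  · filter_upwards [(hd.hasSpectralMatrix hsD).ae_posSemidef,
      (hz.hasSpectralMatrix hsZ).ae_posSemidef, hwhite'] with σ hDσ hZσ hσ
    exact ⟨hp, hDσ, hZσ, hσ⟩

end Cyclostationary

namespace IsSpectralModel

variable {Ω : Type*} [MeasurableSpace Ω] {μ : Measure Ω} {P : ℕ} {p r : ℝ} {d x : ℤ → Ω → ℂ}
  {D X DX : ℝ → Matrix (Fin P) (Fin P) ℂ}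

theorem trace_errMat_ae_eq_coherence (h : IsSpectralModel μ P p d x D X)
    (hDX : DX =ᵐ[band P] D) :
    (fun σ => (errMat D X σ).trace) =ᵐ[band P] fun σ =>
      (D σ * (1 - cohMat (D σ) (DX σ) (X σ) * (cohMat (D σ) (DX σ) (X σ))ᴴ)).trace := by
  filter_upwards [h.white, hDX] with σ hσ hDXσ
  rw [hDXσ, hσ.trace_mul_one_sub_cohMat, errMat]

theorem trace_errMat_ae_eq_of_sub_ae_eq (h : IsSpectralModel μ P p d x D X)
    (hr : X - D =ᵐ[band P] fun _ => (r : ℂ) • 1) :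
    (fun σ => (errMat D X σ).trace) =ᵐ[band P] fun σ =>
      (r : ℂ) * (D σ * (D σ + (r : ℂ) • 1)⁻¹).trace := by
  filter_upwards [h.white, hr] with σ hσ hrσ
  rw [errMat, hσ.sub_mul_inv_mul_eq_smul hrσ, ← hrσ, Pi.sub_apply, add_sub_cancel,
    Matrix.trace_smul, smul_eq_mul]

theorem integrable_trace_mul_inv_add_smul (h : IsSpectralModel μ P p d x D X) (hr0 : r ≠ 0)
    (hr : X - D =ᵐ[band P] fun _ => (r : ℂ) • 1) :
    Integrable (fun σ => (D σ * (D σ + (r : ℂ) • 1)⁻¹).trace) (band P) :=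
  (integrable_const_mul_iff (Complex.ofReal_ne_zero.2 hr0).isUnit _).1
    (h.integrable_trace_errMat.congr (h.trace_errMat_ae_eq_of_sub_ae_eq hr))

end IsSpectralModel

theorem theorem2_general {Ω : Type*} [MeasurableSpace Ω] (μ : Measure Ω)
    (P : ℕ) [NeZero P] (d z x : ℤ → Ω → ℂ)
    (hd : IsCyclostationary μ P d) (hz : IsCyclostationary μ P z)
    (hwhite : ∃ p : ℝ, 0 < p ∧ (IsWhite μ p z ∨ IsWhite μ p d))
    (hunc : ∀ n n' : ℤ, ∫ ω, d n ω * conj (z n' ω) ∂μ = 0)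
    (hx : ∀ n ω, x n ω = d n ω + z n ω)
    (sD sX sDX : ℤ → ℝ → ℂ)
    (hsD : IsCyclicSpectrum P (corr μ d d) sD)
    (hsX : IsCyclicSpectrum P (corr μ x x) sX)
    (hsDX : IsCyclicSpectrum P (corr μ d x) sDX)
    (SD SX SDX : ℝ → Matrix (Fin P) (Fin P) ℂ)
    (hSD : SD = cycMat P sD) (hSX : SX = cycMat P sX) (hSDX : SDX = cycMat P sDX) :
    ∃ mmse : ℝ,
      IsLeast (freshMSEs μ P d x SX) mmse ∧
      (∀ W : Fin P → ℝ → ℂ, IsCyclicWiener μ P d x SX W ↔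
        ∀ p q : Fin P, ∀ᵐ σ ∂(band P),
          W q (σ + (p.val : ℝ) / (P : ℝ)) = ((SX σ)⁻¹ * (SDX σ)ᴴ) (p + q) p) ∧
      (∀ (W : Fin P → ℝ → ℂ) (dhat : ℤ → Ω → ℂ), IsCyclicWiener μ P d x SX W →
        IsFreshOutput μ P x SX W dhat → ∀ (n : ℤ) (c : ℤ →₀ ℂ),
          ∫ ω, ‖d n ω - dhat n ω‖ ^ 2 ∂μ
            ≤ ∫ ω, ‖d n ω - c.sum fun m a => a * x m ω‖ ^ 2 ∂μ) ∧
      (∀ B : ℝ → Matrix (Fin P) (Fin P) ℂ, IsKLBasis P SX B →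
        IsKLBasis P SD B ∧
        IsLeast (klMSEs μ P d x SX B) mmse ∧
        (∀ W : Fin P → ℝ → ℂ, IsKLWiener μ P d x SX B W ↔
          ∀ p : Fin P, ∀ᵐ σ ∂(band P),
            W p σ = conj (klSpec P SDX B p σ) / klSpec P SX B p σ) ∧
        (∀ (W W' : Fin P → ℝ → ℂ), IsCyclicWiener μ P d x SX W → IsKLWiener μ P d x SX B W' →
          ∀ dhat : ℤ → Ω → ℂ, IsFreshOutput μ P x SX W dhat ↔ IsKLOutput μ P x SX B W' dhat) ∧
        (∀ (W W' : Fin P → ℝ → ℂ), IsCyclicWiener μ P d x SX W → IsKLWiener μ P d x SX B W' →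
          ∀ dhat dhat' : ℤ → Ω → ℂ, IsFreshOutput μ P x SX W dhat →
            IsKLOutput μ P x SX B W' dhat' → ∀ n, dhat n =ᵐ[μ] dhat' n) ∧
        (∀ p, Integrable
          (fun σ => (klSpec P SD B p σ).re * (1 - klCohSq P SD SX SDX B p σ)) (band P)) ∧
        mmse = ∑ p : Fin P,
          ∫ σ, (klSpec P SD B p σ).re * (1 - klCohSq P SD SX SDX B p σ) ∂(band P)) ∧
      Integrable (fun σ => (SD σ * (1 - cohMat (SD σ) (SDX σ) (SX σ) *
        (cohMat (SD σ) (SDX σ) (SX σ))ᴴ)).trace) (band P) ∧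
      (mmse : ℂ) = ∫ σ, (SD σ * (1 - cohMat (SD σ) (SDX σ) (SX σ) *
        (cohMat (SD σ) (SDX σ) (SX σ))ᴴ)).trace ∂(band P) ∧
      (∀ Pz : ℝ, 0 < Pz → IsWhite μ Pz z →
        Integrable (fun σ => (SD σ * (SD σ + (Pz : ℂ) • 1)⁻¹).trace) (band P) ∧
        (mmse : ℂ) = (Pz : ℂ) * ∫ σ, (SD σ * (SD σ + (Pz : ℂ) • 1)⁻¹).trace ∂(band P)) := by
  obtain ⟨p, hp, hwhite⟩ := hwhite
  obtain rfl : x = d + z := funext₂ hx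
  subst hSD hSX hSDX
  have hdz := corr_eq_zero_iff.2 hunc
  have h := isSpectralModel_cycMat hd hz hp hwhite hdz hsD hsX
  have hDX := cycMat_cross_ae_eq hd.1 hz.1 hdz hsD hsDX
  have htrace := h.trace_errMat_ae_eq_coherence hDX
  refine ⟨minPower _ _, h.isLeast_freshMSEs, fun W => h.isCyclicWiener_iff hDX,
    fun W dhat hW hdhat n c => ?_, fun B hB => ?_, h.integrable_trace_errMat.congr htrace,
    h.ofReal_minPower_eq.trans (integral_congr_ae htrace), fun Pz hPz hwz => ?_⟩
  · simpa only [linearCombination_apply, Finsupp.sum, Finset.sum_apply, Pi.smul_apply,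
      smul_eq_mul] using
      h.integral_norm_sub_sq_le ((h.isFreshOutput_iff_of_isCyclicWiener hW).1 hdhat) n c
  · have hiff {W W'} (hW : IsCyclicWiener μ P d _ _ W) (hW' : IsKLWiener μ P d _ _ B W') dhat :=
      (h.isFreshOutput_iff_of_isCyclicWiener (dhat := dhat) hW).trans
        (h.isKLOutput_iff_of_isKLWiener hB hW').symm
    exact ⟨h.isKLBasis_signal hB, h.isLeast_klMSEs hB, fun W => h.isKLWiener_iff hB hDX,
      fun W W' => hiff, fun W W' hW hW' dhat dhat' hfresh hkl n =>
        h.obs.ae_eq_of_hasCLIntegral (hfresh n) ((hiff hW hW' dhat').2 hkl n),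
      h.integrable_klSpec_mul_one_sub_klCohSq hB hDX, h.minPower_eq_sum_integral_klSpec hB hDX⟩
  · have hnoise := hwz.cycMat_ae_eq (isCyclicSpectrum_noise hd.1 hz.1 hdz hsD hsX)
    refine ⟨h.integrable_trace_mul_inv_add_smul hPz.ne' hnoise, ?_⟩
    rw [h.ofReal_minPower_eq, ← integral_const_mul]
    exact integral_congr_ae (h.trace_errMat_ae_eq_of_sub_ae_eq hnoise)

end

theorem theorem2 {Ω : Type*} [MeasurableSpace Ω] (μ : Measure Ω) [IsProbabilityMeasure μ]
    (P : ℕ) [NeZero P] (d z x : ℤ → Ω → ℂ)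
    (hd : IsCyclostationary μ P d) (hz : IsCyclostationary μ P z)
    (hwhite : ∃ p : ℝ, 0 < p ∧ (IsWhite μ p z ∨ IsWhite μ p d))
    (hunc : ∀ n n' : ℤ, ∫ ω, d n ω * conj (z n' ω) ∂μ = 0)
    (hx : ∀ n ω, x n ω = d n ω + z n ω)
    (sD sX sDX : ℤ → ℝ → ℂ)
    (hsD : IsCyclicSpectrum P (corr μ d d) sD)
    (hsX : IsCyclicSpectrum P (corr μ x x) sX)
    (hsDX : IsCyclicSpectrum P (corr μ d x) sDX)
    (SD SX SDX : ℝ → Matrix (Fin P) (Fin P) ℂ)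
    (hSD : SD = cycMat P sD) (hSX : SX = cycMat P sX) (hSDX : SDX = cycMat P sDX) :
    ∃ mmse : ℝ,
      -- the least error power of FRESH filters, and the cyclic Wiener filter attaining it
      IsLeast (freshMSEs μ P d x SX) mmse ∧
      (∀ W : Fin P → ℝ → ℂ, IsCyclicWiener μ P d x SX W ↔
        ∀ p q : Fin P, ∀ᵐ σ ∂(band P),
          W q (σ + (p.val : ℝ) / (P : ℝ)) = ((SX σ)⁻¹ * (SDX σ)ᴴ) (p + q) p) ∧
      -- its output is the best linear estimate of the signal from all the observations
      (∀ (W : Fin P → ℝ → ℂ) (dhat : ℤ → Ω → ℂ), IsCyclicWiener μ P d x SX W →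
        IsFreshOutput μ P x SX W dhat → ∀ (n : ℤ) (c : ℤ →₀ ℂ),
          ∫ ω, ‖d n ω - dhat n ω‖ ^ 2 ∂μ
            ≤ ∫ ω, ‖d n ω - c.sum fun m a => a * x m ω‖ ^ 2 ∂μ) ∧
      -- in any KL basis of the observation
      (∀ B : ℝ → Matrix (Fin P) (Fin P) ℂ, IsKLBasis P SX B →
        IsKLBasis P SD B ∧
        -- the scalar Wiener filter is the optimal filter in the KL domain
        IsLeast (klMSEs μ P d x SX B) mmse ∧
        (∀ W : Fin P → ℝ → ℂ, IsKLWiener μ P d x SX B W ↔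
          ∀ p : Fin P, ∀ᵐ σ ∂(band P),
            W p σ = conj (klSpec P SDX B p σ) / klSpec P SX B p σ) ∧
        -- it is equivalent to the cyclic Wiener filter: both have the same output process
        (∀ (W W' : Fin P → ℝ → ℂ), IsCyclicWiener μ P d x SX W → IsKLWiener μ P d x SX B W' →
          ∀ dhat : ℤ → Ω → ℂ, IsFreshOutput μ P x SX W dhat ↔ IsKLOutput μ P x SX B W' dhat) ∧
        (∀ (W W' : Fin P → ℝ → ℂ), IsCyclicWiener μ P d x SX W → IsKLWiener μ P d x SX B W' →
          ∀ dhat dhat' : ℤ → Ω → ℂ, IsFreshOutput μ P x SX W dhat →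
            IsKLOutput μ P x SX B W' dhat' → ∀ n, dhat n =ᵐ[μ] dhat' n) ∧
        (∀ p, Integrable
          (fun σ => (klSpec P SD B p σ).re * (1 - klCohSq P SD SX SDX B p σ)) (band P)) ∧
        mmse = ∑ p : Fin P,
          ∫ σ, (klSpec P SD B p σ).re * (1 - klCohSq P SD SX SDX B p σ) ∂(band P)) ∧
      -- the error power through the coherence matrix
      Integrable (fun σ => (SD σ * (1 - cohMat (SD σ) (SDX σ) (SX σ) *
        (cohMat (SD σ) (SDX σ) (SX σ))ᴴ)).trace) (band P) ∧
      (mmse : ℂ) = ∫ σ, (SD σ * (1 - cohMat (SD σ) (SDX σ) (SX σ) *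
        (cohMat (SD σ) (SDX σ) (SX σ))ᴴ)).trace ∂(band P) ∧
      -- the error power for white noise
      (∀ Pz : ℝ, 0 < Pz → IsWhite μ Pz z →
        Integrable (fun σ => (SD σ * (SD σ + (Pz : ℂ) • 1)⁻¹).trace) (band P) ∧
        (mmse : ℂ) = (Pz : ℂ) * ∫ σ, (SD σ * (SD σ + (Pz : ℂ) • 1)⁻¹).trace ∂(band P)) :=
  theorem2_general μ P d z x hd hz hwhite hunc hx sD sX sDX hsD hsX hsDX SD SX SDX hSD hSX hSDX
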